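/- Conventions. A directed multigraph is finite and loopless (parallel edges are allowed, edges from a node to itself are not). The degree of a node is the number of edges, counted with multiplicity, that start or end at it; a node is isolated if its degree is $0$. An undirected multigraph is regarded as a set with binary relations $E_j$ ($j\in\mathbb N=\{0,1,2,\dots\}$), where for $j\ge 1$ $E_j(u,v)$ means that $u$ and $v$ are joined by at least $j$ edges, and $E_0(u,v)$ means $u\ne v$. The *Rado multigraph* is the (unique up to isomorphism) countably infinite structure with binary relations $(E_j)_{j\in\mathbb N}$ such that: (A0) $x\neq y$ implies $E_0(x,y)$; (A1) each $E_j$ is symmetric and irreflexive; (A2) $E_{j+1}(u,v)$ implies $E_j(u,v)$; (A3) for all $u,v$ there is $i$ with $\neg E_i(u,v)$; (A4) for all $n$, all $m_1,\dots,m_n\in\mathbb N$ and all distinct $u_1,\dots,u_n$ there is $w$ with $E_{m_i}(u_i,w)$ and $\neg E_{m_i+1}(u_i,w)$ for every $i$. The process. Let $G'$ be a directed multigraph with node set $\{1,\dots,v'\}$, $v'\ge 1$, without isolated nodes, and let $f:\mathbb N\to\mathbb N$ satisfy $f(t)\ge 1$ for all $t\ge v'$. The process $\mathrm{MPA}_f(G')$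 is the random sequence of directed multigraphs $(G(t))_{t\ge v'}$, where $G(t)$ has node set $\{1,\dots,t\}$, given by $G(v')=G'$ and, for $t\ge v'$, by obtaining $G(t+1)$ from $G(t)$ by adding the node $t+1$ and $f(t)$ edges that start at $t+1$, whose end-points are chosen independently (with replacement, and given $G(t)$ independently of the earlier history) from $\{1,\dots,t\}$ with probabilities proportional to the degrees in $G(t)$. Its infinite limit is the union $\bigcup_{t\ge v'} G(t)$. **Theorem 3.3.** Suppose in addition that $f(t)=\Theta(t)$, i.e. there are constants $c_2\ge c_1>0$ with $c_1t\le f(t)\le c_2t$ for all large enough $t$. Then, with probability $1$, the infinite limit of $\mathrm{MPA}_f(G')$, viewed as an undirected multigraph, is the Rado multigraph: it satisfies (A0)-(A4), and it is isomorphic to every countably infinite structure satisfying (A0)-(A4). -/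

import Mathlib

open MeasureTheory ProbabilityTheory Filter Asymptotics
open scoped ENNReal

noncomputable section

namespace PrefAttach

/-! ### Multigraphs as relational structures, and the Rado multigraph -/

/-- A structure on `V` for the language of undirected multigraphs: one binary relation `E j` for
each natural number `j`. The intended reading of `E j u v` is that `u` and `v` are joined by at
least `j` edges. -/
structure MultiStr (V : Type*) where
  E : ℕ → V → V → Prop

/-- Isomorphisms of such structures. -/
structure MultiStr.Iso {V W : Type*} (M : MultiStr V) (N : MultiStr W) where
  toEquiv : V ≃ W
  map_iff : ∀ j u v, N.E j (toEquiv u) (toEquiv v) ↔ M.E j u v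

/-- `M` is the Rado multigraph: a countably infinite structure satisfying the following
axioms. -/
structure IsRadoMultigraph {V : Type*} (M : MultiStr V) : Prop where
  countable : Countable V
  infinite : Infinite V
  /-- Distinct elements satisfy the zeroth relation. -/
  zero_of_ne : ∀ x y, x ≠ y → M.E 0 x y
  /-- Each relation is symmetric. -/
  symm : ∀ j u v, M.E j u v → M.E j v u
  /-- Each relation is irreflexive (no loops). -/
  irrefl : ∀ j u, ¬ M.E j u u
  /-- At least `j + 1` edges are at least `j` edges. -/
  mono : ∀ j u v, M.E (j + 1) u v → M.E j u v
  /-- No two nodes are joined by infinitely many edges. -/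
  finitary : ∀ u v, ∃ i, ¬ M.E i u v
  /-- Any finite list of distinct nodes and prescribed multiplicities has a witness, joined to the
  `i`-th node by exactly `m i` edges. -/
  extension : ∀ (n : ℕ) (m : Fin n → ℕ) (u : Fin n → V), Function.Injective u →
    ∃ v, ∀ i, M.E (m i) (u i) v ∧ ¬ M.E (m i + 1) (u i) v

/-! ### Finite directed multigraphs -/

/-- A finite multiset of directed edges between nodes labelled by natural numbers; `(a, b)` is an
edge with start-point `a` and end-point `b`. -/
abbrev EdgeMultiset := Multiset (ℕ × ℕ)

instance : MeasurableSpace EdgeMultiset := ⊤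

instance : DiscreteMeasurableSpace EdgeMultiset := ⟨fun _ => trivial⟩

/-- A (loopless) directed multigraph with node set `{0, …, v - 1}`. -/
structure DiMultigraph (v : ℕ) where
  edges : EdgeMultiset
  lt_of_mem : ∀ e ∈ edges, e.1 < v ∧ e.2 < v
  loopless : ∀ e ∈ edges, e.1 ≠ e.2

/-- The degree of `u`: the number of edges, with multiplicity, that start at `u` plus the number
that end at `u`. -/
def degree (E : EdgeMultiset) (u : ℕ) : ℕ :=
  E.countP (fun e => e.1 = u) + E.countP (fun e => e.2 = u)

/-- A directed multigraph without isolated nodes, that is, without nodes of degree `0`. -/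
def DiMultigraph.NoIsolated {v : ℕ} (G : DiMultigraph v) : Prop :=
  ∀ u < v, degree G.edges u ≠ 0

/-- The number of edges, in either direction, between `u` and `v`. -/
def joining (E : EdgeMultiset) (u v : ℕ) : ℕ :=
  E.countP (fun e => e = (u, v) ∨ e = (v, u))

/-- The undirected multigraph underlying `E`: for `j ≥ 1`, `u` and `v` are related by the `j`-th
relation when at least `j` edges join them; the zeroth relation is `u ≠ v`. -/
def undirected (E : EdgeMultiset) : MultiStr ℕ where
  E j u v := (j = 0 ∧ u ≠ v) ∨ (1 ≤ j ∧ j ≤ joining E u v)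

/-! ### The preferential attachment process -/

/-- The weight of `u` in the choice of an end-point at stage `t`: its degree if `u` belongs to
the node set `{0, …, t - 1}`, and `0` otherwise. -/
def weight (t : ℕ) (E : EdgeMultiset) (u : ℕ) : ℝ≥0∞ :=
  if u < t then (degree E u : ℝ≥0∞) else 0

theorem tsum_weight_ne_top (t : ℕ) (E : EdgeMultiset) : ∑' u, weight t E u ≠ ∞ := by
  rw [tsum_eq_sum (s := Finset.range t)
    (fun u hu => by simp only [weight, if_neg (by simpa using hu : ¬ u < t)])]
  refine ENNReal.sum_ne_top.2 fun u _ => ?_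
  unfold weight
  split_ifs <;> simp

open Classical in
/-- The distribution on the node set `{0, …, t - 1}` in which every node has probability directly
proportional to its degree in the multigraph with edges `E`. (If all these degrees are `0` there
is no such distribution, and the value is irrelevant: such an `E` does not occur in the process
below when it is started from a nonempty multigraph without isolated nodes.) -/
def endpointPMF (t : ℕ) (E : EdgeMultiset) : PMF ℕ :=
  if h : ∑' u, weight t E u ≠ 0 then PMF.normalize (weight t E) h (tsum_weight_ne_top t E)
  else PMF.pure 0

/-- The edges added when `{0, …, t - 1}` is the current node set: each starts at the new node `t`,
and the `i`-th one ends at `c i`. -/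
def newEdges (t : ℕ) {k : ℕ} (c : Fin k → ℕ) : EdgeMultiset :=
  (Finset.univ : Finset (Fin k)).val.map fun i => (t, c i)

/-- The law of the edge multiset at time `t + 1`, given that it is `E` at time `t`, for a process
started from a multigraph with `v` nodes. If `t < v` nothing happens. If `t ≥ v` then `f t` edges
are added from the new node, with end-points chosen independently, with replacement, with
probabilities proportional to degree. -/
def stepLaw (f : ℕ → ℕ) (v t : ℕ) (E : EdgeMultiset) : Measure EdgeMultiset :=
  if t < v then Measure.dirac E
  else (Measure.pi fun _ : Fin (f t) => (endpointPMF t E).toMeasure).map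
    fun c => E + newEdges t c

instance (f : ℕ → ℕ) (v t : ℕ) (E : EdgeMultiset) : IsProbabilityMeasure (stepLaw f v t E) := by
  unfold stepLaw
  split_ifs
  · infer_instance
  · exact Measure.isProbabilityMeasure_map (Measurable.of_discrete).aemeasurable

/-- The transition kernel from the history up to time `t` to the edge multiset at time `t + 1`; it
depends only on the edge multiset at time `t`. -/
def stepKernel (f : ℕ → ℕ) (v t : ℕ) :
    Kernel ((i : Finset.Iic t) → (fun _ : ℕ => EdgeMultiset) i) EdgeMultiset :=
  (Kernel.ofFunOfCountable (stepLaw f v t)).comap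
    (fun h => h ⟨t, Finset.mem_Iic.2 le_rfl⟩) (measurable_pi_apply _)

instance (f : ℕ → ℕ) (v t : ℕ) : IsMarkovKernel (stepKernel f v t) where
  isProbabilityMeasure h :=
    inferInstanceAs (IsProbabilityMeasure (stepLaw f v t (h ⟨t, Finset.mem_Iic.2 le_rfl⟩)))

/-- The law of the process `MPA_f(G)`, as a probability measure on the sequences
`(E(0), E(1), E(2), …)` of edge multisets. For `t ≥ v` the multigraph at time `t` has node set
`{0, …, t - 1}` and edges `E(t)`; at all times `t ≤ v` the edges are those of `G`. -/
def mpa (f : ℕ → ℕ) {v : ℕ} (G : DiMultigraph v) : Measure (ℕ → EdgeMultiset) :=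
  Kernel.trajMeasure (X := fun _ => EdgeMultiset) (Measure.dirac G.edges) (stepKernel f v)

instance (f : ℕ → ℕ) {v : ℕ} (G : DiMultigraph v) : IsProbabilityMeasure (mpa f G) :=
  inferInstanceAs (IsProbabilityMeasure
    (Kernel.trajMeasure (X := fun _ => EdgeMultiset) (Measure.dirac G.edges) (stepKernel f v)))

/-- The infinite limit, viewed as an undirected multigraph: the union of the undirected
multigraphs on `{0, …, t - 1}` with edges `E(t)`. -/
def limit (E : ℕ → EdgeMultiset) : MultiStr ℕ where
  E j u v := ∃ t, u < t ∧ v < t ∧ (undirected (E t)).E j u v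

end PrefAttach

end

noncomputable section

namespace PrefAttach

section

/-! ### Uniqueness of the Rado multigraph -/

/-! Uniqueness is a back-and-forth argument: (A4) extends every finite partial isomorphism by one
point on either side. For existence only (A4) is in doubt, because all edges between two nodes are
present once the later one has arrived.

Fix nodes u_i and numbers m_i. The number e(t) of edges is of order t², so if the degrees of the u_i
are of order t, each of the f(t) = Θ(t) end-points chosen by node t hits u_i with probability of
order 1/t. The hit counts are then roughly Poisson, and the conditional probability that they equal
the m_i stays away from 0 (`IsTrajectory.exists_le_integral`). Lévy's conditional Borel–Cantelli
lemma gives infinitely many witnesses almost surely (`ae_frequently_joining_eq`), and there are only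
countably many choices of u and m.

The main point is that degrees grow linearly (`ae_degree_linear`). With r = f(t)/(2e(t)), a degree
grows by the factor 1 + r in conditional mean, while √e(t), of order t, grows by √(1 + 2r) = 1 + r +
O(r²). As r = O(1/t), the errors are summable and a damping factor absorbs them. So degree/√e and
√e/(degree − 1), suitably damped, are nonnegative supermartingales, hence almost surely bounded
(`ae_bddAbove_of_integral_le`). The second needs degree at least 2; every node gets there, because
√e(t)·1[degree = 1] is a supermartingale too while √e(t) → ∞. -/

theorem IsRadoMultigraph.mono_le {V : Type*} {M : MultiStr V} (hM : IsRadoMultigraph M)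
    {i j : ℕ} (hij : i ≤ j) {u v : V} (h : M.E j u v) : M.E i u v := by
  induction hij with
  | refl => exact h
  | step _ ih => exact ih (hM.mono _ _ _ h)

/-- Distinct nodes are joined by a well-defined finite number of edges. -/
theorem IsRadoMultigraph.exists_mult {V : Type*} {M : MultiStr V} (hM : IsRadoMultigraph M)
    {u v : V} (huv : u ≠ v) : ∃ m, ∀ j, M.E j u v ↔ j ≤ m := by
  classical
  have hex := hM.finitary u v
  -- The least failing index is positive since relation 0 holds, so its predecessor is the
  -- multiplicity.
  have h0 : Nat.find hex ≠ 0 := fun h =>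
    (h ▸ Nat.find_spec hex : ¬ M.E 0 u v) (hM.zero_of_ne u v huv)
  refine ⟨Nat.find hex - 1, fun j => ⟨fun hj => ?_, fun hj => ?_⟩⟩
  · by_contra hlt
    exact Nat.find_spec hex (hM.mono_le (by omega) hj)
  · by_contra hn
    have := Nat.find_min' hex hn
    omega

/-- Finite partial isomorphisms between two structures, given as finite sets of pairs of nodes that
are to be identified. -/
def PartialIso {V W : Type*} (M : MultiStr V) (N : MultiStr W) : Type _ :=
  {F : Finset (V × W) // ∀ p ∈ F, ∀ q ∈ F, ∀ j, M.E j p.1 q.1 ↔ N.E j p.2 q.2}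

namespace PartialIso

variable {V W : Type*} {M : MultiStr V} {N : MultiStr W}

instance : Preorder (PartialIso M N) := Preorder.lift Subtype.val

instance : Inhabited (PartialIso M N) := ⟨⟨∅, fun _ h => (Finset.notMem_empty _ h).elim⟩⟩

/-- In a Rado multigraph relation 0 is exactly inequality, so preserving it already makes a partial
isomorphism well defined and injective. -/
theorem fst_eq_iff (hM : IsRadoMultigraph M) (hN : IsRadoMultigraph N) (F : PartialIso M N)
    {p q : V × W} (hp : p ∈ F.val) (hq : q ∈ F.val) : p.1 = q.1 ↔ p.2 = q.2 := by
  have h := F.prop p hp q hq 0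
  constructor
  · intro e
    by_contra hne
    exact hM.irrefl 0 q.1 (e ▸ h.2 (hN.zero_of_ne _ _ hne))
  · intro e
    by_contra hne
    exact hN.irrefl 0 q.2 (e ▸ h.1 (hM.zero_of_ne _ _ hne))

/-- The one-point extension step: the multiplicities from the domain to a new `a` are finite
numbers, and the extension axiom of `N` realises the same numbers over the image points. -/
theorem exists_across (hM : IsRadoMultigraph M) (hN : IsRadoMultigraph N) (F : PartialIso M N)
    (a : V) : ∃ b : W, ∀ p ∈ F.val, ∀ j, M.E j p.1 a ↔ N.E j p.2 b := by
  classical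
  by_cases h : ∃ b, (a, b) ∈ F.val
  · obtain ⟨b, hb⟩ := h
    exact ⟨b, fun p hp j => F.prop p hp _ hb j⟩
  have hne : ∀ p ∈ F.val, p.1 ≠ a := fun p hp e => h ⟨p.2, e ▸ hp⟩
  choose! m hm using fun p (hp : p ∈ F.val) => hM.exists_mult (hne p hp)
  let s := F.val.equivFin.symm
  obtain ⟨b, hb⟩ := hN.extension F.val.card (fun i => m (s i)) (fun i => (s i : V × W).2) (by
    intro i j hij
    apply s.injective
    apply Subtype.ext
    exact Prod.ext ((F.fst_eq_iff hM hN (s i).2 (s j).2).2 hij) hij)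
  refine ⟨b, fun p hp j => ?_⟩
  have h1 := hb (s.symm ⟨p, hp⟩)
  simp only [Equiv.apply_symm_apply] at h1
  rw [hm p hp]
  refine ⟨fun hj => hN.mono_le hj h1.1, fun hj => ?_⟩
  by_contra hlt
  exact h1.2 (hN.mono_le (by omega) hj)

/-- The inverse of a partial isomorphism. -/
def comm (F : PartialIso M N) : PartialIso N M := by
  classical
  refine ⟨F.val.image Prod.swap, ?_⟩
  intro p hp q hq j
  obtain ⟨p', hp', rfl⟩ := Finset.mem_image.1 hp
  obtain ⟨q', hq', rfl⟩ := Finset.mem_image.1 hq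
  exact (F.prop p' hp' q' hq' j).symm

theorem mem_comm (F : PartialIso M N) (a : V) (b : W) : (b, a) ∈ F.comm.val ↔ (a, b) ∈ F.val := by
  classical
  simp [comm]

theorem exists_extend_left (hM : IsRadoMultigraph M) (hN : IsRadoMultigraph N)
    (F : PartialIso M N) (a : V) : ∃ F' : PartialIso M N, (∃ b, (a, b) ∈ F'.val) ∧ F ≤ F' := by
  classical
  obtain ⟨b, hb⟩ := F.exists_across hM hN a
  refine ⟨⟨insert (a, b) F.val, fun p hp q hq j => ?_⟩, ⟨b, Finset.mem_insert_self _ _⟩,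
    Finset.subset_insert _ _⟩
  rcases Finset.mem_insert.1 hp with rfl | hp <;> rcases Finset.mem_insert.1 hq with rfl | hq
  · exact iff_of_false (hM.irrefl j a) (hN.irrefl j b)
  · exact ⟨fun h => hN.symm _ _ _ ((hb q hq j).1 (hM.symm _ _ _ h)),
      fun h => hM.symm _ _ _ ((hb q hq j).2 (hN.symm _ _ _ h))⟩
  · exact hb p hp j
  · exact F.prop p hp q hq j

theorem exists_extend_right (hM : IsRadoMultigraph M) (hN : IsRadoMultigraph N)
    (F : PartialIso M N) (b : W) : ∃ F' : PartialIso M N, (∃ a, (a, b) ∈ F'.val) ∧ F ≤ F' := by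
  obtain ⟨F', ⟨a, ha⟩, hF⟩ := F.comm.exists_extend_left hN hM b
  refine ⟨F'.comm, ⟨a, (F'.mem_comm b a).2 ha⟩, ?_⟩
  rintro ⟨x, y⟩ hxy
  exact (F'.mem_comm y x).2 (hF ((F.mem_comm x y).2 hxy))

end PartialIso

/-- Any two Rado multigraphs are isomorphic. -/
theorem IsRadoMultigraph.nonempty_iso {V W : Type*} {M : MultiStr V} {N : MultiStr W}
    (hM : IsRadoMultigraph M) (hN : IsRadoMultigraph N) : Nonempty (MultiStr.Iso M N) := by
  classical
  have := hM.countable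
  have := hN.countable
  have := Encodable.ofCountable V
  have := Encodable.ofCountable W
  let D : V ⊕ W → Order.Cofinal (PartialIso M N) := fun x => Sum.rec
    (fun a => ⟨{F | ∃ b, (a, b) ∈ F.val}, fun F => F.exists_extend_left hM hN a⟩)
    (fun b => ⟨{F | ∃ a, (a, b) ∈ F.val}, fun F => F.exists_extend_right hM hN b⟩) x
  -- An ideal meeting the countably many cofinal sets "`a` is in the domain" and "`b` is in the
  -- range". Its members are pairwise compatible by directedness, so their union is a bijection.
  let I : Order.Ideal (PartialIso M N) := Order.idealOfCofinals default D
  have hI := Order.cofinal_meets_idealOfCofinals (default : PartialIso M N) D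
  have hl : ∀ a : V, ∃ b : W, ∃ F ∈ I, (a, b) ∈ F.val := fun a => by
    obtain ⟨F, ⟨b, hb⟩, hF⟩ := hI (Sum.inl a)
    exact ⟨b, F, hF, hb⟩
  have hr : ∀ b : W, ∃ a : V, ∃ F ∈ I, (a, b) ∈ F.val := fun b => by
    obtain ⟨F, ⟨a, ha⟩, hF⟩ := hI (Sum.inr b)
    exact ⟨a, F, hF, ha⟩
  choose φ Fφ hFφ hφ using hl
  choose ψ Fψ hFψ hψ using hr
  refine ⟨⟨⟨φ, ψ, fun a => ?_, fun b => ?_⟩, fun j u v => ?_⟩⟩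
  · obtain ⟨F, -, h1, h2⟩ := I.directed _ (hFφ a) _ (hFψ (φ a))
    exact (F.fst_eq_iff hM hN (h2 (hψ _)) (h1 (hφ _))).2 rfl
  · obtain ⟨F, -, h1, h2⟩ := I.directed _ (hFψ b) _ (hFφ (ψ b))
    exact (F.fst_eq_iff hM hN (h2 (hφ _)) (h1 (hψ _))).1 rfl
  · obtain ⟨F, -, h1, h2⟩ := I.directed _ (hFφ u) _ (hFφ v)
    exact (F.prop _ (h1 (hφ u)) _ (h2 (hφ v)) j).symm

end

section

/-! ### Deterministic facts about edge multisets -/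

/-- `E` is the edge multiset of a loopless multigraph with node set `{0, …, t - 1}` and without
isolated nodes. -/
structure IsValid (t : ℕ) (E : EdgeMultiset) : Prop where
  lt_of_mem : ∀ e ∈ E, e.1 < t ∧ e.2 < t
  loopless : ∀ e ∈ E, e.1 ≠ e.2
  degree_ne_zero : ∀ u < t, degree E u ≠ 0

theorem DiMultigraph.NoIsolated.isValid {v : ℕ} {G : DiMultigraph v} (hG : G.NoIsolated) :
    IsValid v G.edges :=
  ⟨G.lt_of_mem, G.loopless, hG⟩

/-- The number of entries of `c` that are equal to `u`. -/
def hits {k : ℕ} (c : Fin k → ℕ) (u : ℕ) : ℕ := (Finset.univ.filter fun i => c i = u).card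

theorem card_newEdges (t : ℕ) {k : ℕ} (c : Fin k → ℕ) : Multiset.card (newEdges t c) = k := by
  simp [newEdges]

theorem mem_newEdges {t : ℕ} {k : ℕ} {c : Fin k → ℕ} {e : ℕ × ℕ} :
    e ∈ newEdges t c ↔ ∃ i, (t, c i) = e := by
  simp [newEdges]

theorem countP_newEdges (t : ℕ) {k : ℕ} (c : Fin k → ℕ) (P : ℕ × ℕ → Prop) [DecidablePred P] :
    (newEdges t c).countP P = (Finset.univ.filter fun i => P (t, c i)).card := by
  rw [newEdges, Multiset.countP_map]
  rfl

theorem degree_add_newEdges (E : EdgeMultiset) {t u : ℕ} (hu : u ≠ t) {k : ℕ} (c : Fin k → ℕ) :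
    degree (E + newEdges t c) u = degree E u + hits c u := by
  have : ∀ i : Fin k, ¬ t = u := fun _ => hu.symm
  simp only [degree, Multiset.countP_add, countP_newEdges, hits, hu.symm, Finset.filter_false,
    Finset.card_empty]
  omega

theorem degree_add_newEdges_self (E : EdgeMultiset) (t : ℕ) {k : ℕ} (c : Fin k → ℕ) :
    k ≤ degree (E + newEdges t c) t := by
  simp only [degree, Multiset.countP_add, countP_newEdges, Finset.filter_true, Finset.card_univ,
    Fintype.card_fin]
  omega

theorem degree_mono {E F : EdgeMultiset} (h : E ≤ F) (u : ℕ) : degree E u ≤ degree F u :=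
  add_le_add (Multiset.countP_le_of_le _ h) (Multiset.countP_le_of_le _ h)

theorem degree_le_card (E : EdgeMultiset) (u : ℕ) : degree E u ≤ 2 * Multiset.card E := by
  have h1 := Multiset.countP_le_card (fun e : ℕ × ℕ => e.1 = u) E
  have h2 := Multiset.countP_le_card (fun e : ℕ × ℕ => e.2 = u) E
  unfold degree
  omega

theorem joining_mono {E F : EdgeMultiset} (h : E ≤ F) (u w : ℕ) : joining E u w ≤ joining F u w :=
  Multiset.countP_le_of_le _ h

theorem joining_comm (E : EdgeMultiset) (u w : ℕ) : joining E u w = joining E w u :=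
  Multiset.countP_congr rfl fun _ _ => propext or_comm

theorem joining_add_newEdges_of_ne (E : EdgeMultiset) {t u w : ℕ} (hu : u ≠ t) (hw : w ≠ t) {k : ℕ}
    (c : Fin k → ℕ) : joining (E + newEdges t c) u w = joining E u w := by
  simp [joining, Multiset.countP_add, countP_newEdges, hu.symm, hw.symm]

theorem joining_add_newEdges_self (E : EdgeMultiset) {t u : ℕ} (hu : u ≠ t) {k : ℕ}
    (c : Fin k → ℕ) : joining (E + newEdges t c) u t = joining E u t + hits c u := by
  simp [joining, Multiset.countP_add, countP_newEdges, hu.symm, hits]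

theorem IsValid.joining_self {t : ℕ} {E : EdgeMultiset} (h : IsValid t E) (u : ℕ) :
    joining E u u = 0 := by
  refine Multiset.countP_eq_zero.2 fun e he => ?_
  rintro (rfl | rfl) <;> exact h.loopless _ he rfl

theorem IsValid.joining_eq_zero {t : ℕ} {E : EdgeMultiset} (h : IsValid t E) (u : ℕ) :
    joining E u t = 0 := by
  refine Multiset.countP_eq_zero.2 fun e he => ?_
  have := h.lt_of_mem e he
  rintro (rfl | rfl)
  · exact lt_irrefl _ this.2
  · exact lt_irrefl _ this.1

theorem IsValid.add_newEdges {t : ℕ} {E : EdgeMultiset} (h : IsValid t E) {k : ℕ} (hk : 1 ≤ k)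
    {c : Fin k → ℕ} (hc : ∀ i, c i < t) : IsValid (t + 1) (E + newEdges t c) := by
  refine ⟨fun e he => ?_, fun e he => ?_, fun u hu => ?_⟩
  · rcases Multiset.mem_add.1 he with he | he
    · have := h.lt_of_mem e he
      omega
    · obtain ⟨i, rfl⟩ := mem_newEdges.1 he
      have := hc i
      simp only
      omega
  · rcases Multiset.mem_add.1 he with he | he
    · exact h.loopless e he
    · obtain ⟨i, rfl⟩ := mem_newEdges.1 he
      exact (hc i).ne'
  · rcases (Nat.lt_succ_iff_lt_or_eq.1 hu) with hu | rfl
    · have := h.degree_ne_zero u hu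
      rw [degree_add_newEdges _ hu.ne]
      omega
    · have := degree_add_newEdges_self E u c
      omega

theorem sum_degree (t : ℕ) (E : EdgeMultiset) (h : ∀ e ∈ E, e.1 < t ∧ e.2 < t) :
    ∑ u ∈ Finset.range t, degree E u = 2 * Multiset.card E := by
  induction E using Multiset.induction_on with
  | empty => simp [degree]
  | cons a E ih =>
    have ha := h a (Multiset.mem_cons_self _ _)
    have : ∀ u, degree (a ::ₘ E) u =
        degree E u + ((if a.1 = u then 1 else 0) + (if a.2 = u then 1 else 0)) := fun u => by
      simp only [degree, Multiset.countP_cons]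
      omega
    simp only [this, Finset.sum_add_distrib, Finset.sum_ite_eq, Finset.mem_range, ha.1, ha.2,
      if_true, Multiset.card_cons, ih fun e he => h e (Multiset.mem_cons_of_mem he)]
    omega

theorem IsValid.card_pos {t : ℕ} {E : EdgeMultiset} (h : IsValid t E) (ht : 0 < t) :
    0 < Multiset.card E := by
  have := h.degree_ne_zero 0 ht
  have := degree_le_card E 0
  omega

theorem IsValid.tsum_weight {t : ℕ} {E : EdgeMultiset} (h : IsValid t E) :
    ∑' u, weight t E u = 2 * Multiset.card E := by
  rw [tsum_eq_sum (s := Finset.range t)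
    (fun u hu => by simp only [weight, if_neg (by simpa using hu : ¬ u < t)])]
  have : ∀ u ∈ Finset.range t, weight t E u = (degree E u : ℝ≥0∞) := fun u hu => by
    simp only [weight, if_pos (Finset.mem_range.1 hu)]
  rw [Finset.sum_congr rfl this]
  exact_mod_cast congrArg (Nat.cast : ℕ → ℝ≥0∞) (sum_degree t E h.lt_of_mem)

theorem IsValid.endpointPMF_apply {t : ℕ} {E : EdgeMultiset} (h : IsValid t E) (ht : 0 < t)
    (u : ℕ) : endpointPMF t E u = weight t E u * (2 * Multiset.card E : ℝ≥0∞)⁻¹ := by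
  have hne : ∑' u, weight t E u ≠ 0 := by
    rw [h.tsum_weight]
    have := h.card_pos ht
    simp [this.ne']
  rw [endpointPMF, dif_pos hne, PMF.normalize_apply, h.tsum_weight]

theorem IsValid.endpointPMF_of_le {t : ℕ} {E : EdgeMultiset} (h : IsValid t E) (ht : 0 < t)
    {u : ℕ} (hu : t ≤ u) : endpointPMF t E u = 0 := by
  rw [h.endpointPMF_apply ht, weight, if_neg hu.not_gt, zero_mul]

theorem IsValid.measureReal_endpointPMF {t : ℕ} {E : EdgeMultiset} (h : IsValid t E) (ht : 0 < t)
    {u : ℕ} (hu : u < t) :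
    (endpointPMF t E).toMeasure.real {u} = degree E u / (2 * Multiset.card E) := by
  rw [measureReal_def, PMF.toMeasure_apply_singleton _ _ (measurableSet_singleton _),
    h.endpointPMF_apply ht, weight, if_pos hu]
  simp [div_eq_mul_inv]

end

section

/-! ### The Markov property and almost sure invariants -/

/-- The filtration generated by the process. -/
abbrev history : Filtration ℕ (MeasurableSpace.pi : MeasurableSpace (ℕ → EdgeMultiset)) :=
  Filtration.piLE (X := fun _ : ℕ => EdgeMultiset)

theorem history_eq_comap (t : ℕ) :
    (history t : MeasurableSpace (ℕ → EdgeMultiset)) =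
      MeasurableSpace.comap (Preorder.frestrictLe t) inferInstance :=
  Filtration.piLE_eq_comap_frestrictLe t

theorem measurable_history {s t : ℕ} (hst : s ≤ t) :
    Measurable[history t] (fun ω : ℕ → EdgeMultiset => ω s) := by
  rw [history_eq_comap]
  exact (measurable_pi_apply (X := fun _ : Finset.Iic t => EdgeMultiset)
    (⟨s, Finset.mem_Iic.2 hst⟩ : Finset.Iic t)).comp (comap_measurable _)

variable {f : ℕ → ℕ} {v : ℕ} {G : DiMultigraph v}

/-- The Markov property: given the history, the next state has the kernel as conditional law.
Conditional expectations thereby become integrals over explicit product measures. -/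
theorem condExp_next (t : ℕ) {g : EdgeMultiset → ℝ}
    (hg : Integrable (fun ω : ℕ → EdgeMultiset => g (ω (t + 1))) (mpa f G)) :
    (mpa f G)[fun ω => g (ω (t + 1)) | history t] =ᵐ[mpa f G]
      fun ω => ∫ y, g y ∂stepLaw f v t (ω t) := by
  have h1 := Kernel.condDistrib_trajMeasure (X := fun _ : ℕ => EdgeMultiset) (κ := stepKernel f v)
    (μ₀ := Measure.dirac G.edges) (a := t)
  have h2 := condExp_ae_eq_integral_condDistrib (μ := mpa f G)
    (X := Preorder.frestrictLe (π := fun _ : ℕ => EdgeMultiset) t)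
    (Y := fun ω => ω (t + 1)) (mβ := MeasurableSpace.pi) (f := g)
    (Preorder.measurable_frestrictLe (X := fun _ : ℕ => EdgeMultiset) t)
    (measurable_pi_apply _).aemeasurable (Measurable.of_discrete (f := g)).stronglyMeasurable hg
  rw [← history_eq_comap] at h2
  have h3 := ae_of_ae_map (Preorder.measurable_frestrictLe t).aemeasurable h1
  filter_upwards [h2, h3] with ω h2 h3
  rw [h2]
  change ∫ y, g y ∂(condDistrib (fun x : ℕ → EdgeMultiset => x (t + 1)) (Preorder.frestrictLe t)
    (Kernel.trajMeasure (Measure.dirac G.edges) (stepKernel f v))) _ = _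
  rw [h3]
  rfl

/-- The joint law of history and next state is a composition-product, so an almost sure property of
a transition can be checked under the step law alone. -/
theorem ae_next (t : ℕ) {P : EdgeMultiset → EdgeMultiset → Prop}
    (h : ∀ᵐ ω ∂mpa f G, ∀ᵐ y ∂stepLaw f v t (ω t), P (ω t) y) :
    ∀ᵐ ω ∂mpa f G, P (ω t) (ω (t + 1)) := by
  have h1 := Kernel.map_frestrictLe_trajMeasure_compProd_eq_map_trajMeasure
    (X := fun _ : ℕ => EdgeMultiset) (κ := stepKernel f v)
    (μ₀ := Measure.dirac G.edges) (a := t)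
  let A : Set (((i : Finset.Iic t) → (fun _ : ℕ => EdgeMultiset) i) × EdgeMultiset) :=
    {p | P (p.1 ⟨t, Finset.mem_Iic.2 le_rfl⟩) p.2}
  have hA : MeasurableSet A := by
    have : A = (fun p => (p.1 ⟨t, Finset.mem_Iic.2 le_rfl⟩, p.2)) ⁻¹' {q | P q.1 q.2} := rfl
    rw [this]
    exact (((measurable_pi_apply _).comp measurable_fst).prodMk measurable_snd)
      (MeasurableSet.of_discrete)
  have h2 : ∀ᵐ p ∂((mpa f G).map (Preorder.frestrictLe t) ⊗ₘ stepKernel f v t), p ∈ A := by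
    refine (Measure.ae_compProd_iff hA).2 ?_
    have hm : MeasurableSet {x : (i : Finset.Iic t) → (fun _ : ℕ => EdgeMultiset) i |
        ∀ᵐ y ∂stepKernel f v t x, (x, y) ∈ A} :=
      (measurable_pi_apply (X := fun _ : Finset.Iic t => EdgeMultiset)
        (⟨t, Finset.mem_Iic.2 le_rfl⟩ : Finset.Iic t))
        (MeasurableSet.of_discrete (s := {E | ∀ᵐ y ∂stepLaw f v t E, P E y}))
    exact (ae_map_iff (Preorder.measurable_frestrictLe t).aemeasurable hm).2 h
  rw [mpa, h1] at h2
  exact ae_of_ae_map (((Preorder.measurable_frestrictLe t).prodMk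
    (measurable_pi_apply _)).aemeasurable) h2

theorem ae_zero : ∀ᵐ ω ∂mpa f G, ω 0 = G.edges := by
  have : (mpa f G).map (fun ω => ω 0) = Measure.dirac G.edges := by
    rw [mpa, Kernel.trajMeasure, Measure.map_dirac' (MeasurableEquiv.measurable _),
      Measure.dirac_bind (Kernel.measurable _)]
    have h0 : (fun ω : ℕ → EdgeMultiset => ω 0) =
        (fun x : (i : Finset.Iic 0) → (fun _ : ℕ => EdgeMultiset) i =>
          x ⟨0, Finset.mem_Iic.2 le_rfl⟩) ∘ Preorder.frestrictLe 0 := rfl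
    have hm : Measurable (fun x : (i : Finset.Iic 0) → (fun _ : ℕ => EdgeMultiset) i =>
        x ⟨0, Finset.mem_Iic.2 le_rfl⟩) := measurable_pi_apply _
    rw [h0, ← Measure.map_map hm (Preorder.measurable_frestrictLe 0),
      Kernel.traj_map_frestrictLe_apply, Kernel.partialTraj_self, Kernel.id_apply,
      Measure.map_dirac' hm]
    rfl
  have h2 : ∀ᵐ y ∂(mpa f G).map (fun ω => ω 0), y = G.edges := by
    rw [this]
    exact (ae_dirac_iff MeasurableSet.of_discrete).2 rfl
  exact ae_of_ae_map (measurable_pi_apply 0).aemeasurable h2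

/-- The number of edges at time `t`. -/
def edgeCount (f : ℕ → ℕ) {v : ℕ} (G : DiMultigraph v) (t : ℕ) : ℕ :=
  Multiset.card G.edges + ∑ s ∈ Finset.Ico v t, f s

theorem edgeCount_succ {t : ℕ} (ht : v ≤ t) : edgeCount f G (t + 1) = edgeCount f G t + f t := by
  rw [edgeCount, Finset.sum_Ico_succ_top ht, edgeCount]
  omega

theorem edgeCount_of_le {t : ℕ} (ht : t ≤ v) : edgeCount f G t = Multiset.card G.edges := by
  simp [edgeCount, Finset.Ico_eq_empty_of_le ht]

/-- The invariants of the process at time `t`. -/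
structure IsState (f : ℕ → ℕ) {v : ℕ} (G : DiMultigraph v) (t : ℕ) (E : EdgeMultiset) : Prop where
  isValid : IsValid (max t v) E
  card_eq : Multiset.card E = edgeCount f G t

/-- The relation between the states at two successive times. -/
def IsStep (f : ℕ → ℕ) (v t : ℕ) (E F : EdgeMultiset) : Prop :=
  (t < v ∧ F = E) ∨ (v ≤ t ∧ ∃ c : Fin (f t) → ℕ, (∀ i, c i < t) ∧ F = E + newEdges t c)

theorem IsStep.le {t : ℕ} {E F : EdgeMultiset} (h : IsStep f v t E F) : E ≤ F := by
  rcases h with ⟨-, rfl⟩ | ⟨-, c, -, rfl⟩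
  · exact le_rfl
  · exact Multiset.le_add_right _ _

theorem IsState.succ (hpos : ∀ t, v ≤ t → 1 ≤ f t) {t : ℕ} {E F : EdgeMultiset}
    (hE : IsState f G t E) (h : IsStep f v t E F) : IsState f G (t + 1) F := by
  rcases h with ⟨ht, rfl⟩ | ⟨ht, c, hc, rfl⟩
  · refine ⟨?_, ?_⟩
    · have := hE.isValid
      rwa [max_eq_right (by omega)] at this ⊢
    · rw [hE.card_eq, edgeCount_of_le ht.le, edgeCount_of_le ht]
  · refine ⟨?_, ?_⟩
    · have := hE.isValid
      rw [max_eq_left (by omega)] at this ⊢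
      exact this.add_newEdges (hpos t ht) hc
    · rw [Multiset.card_add, card_newEdges, hE.card_eq, edgeCount_succ ht]

theorem ae_pi_lt {t : ℕ} {E : EdgeMultiset} (h : IsValid t E) (ht : 0 < t) (k : ℕ) :
    ∀ᵐ c ∂(Measure.pi fun _ : Fin k => (endpointPMF t E).toMeasure), ∀ i, c i < t := by
  refine ae_all_iff.2 fun i => ?_
  have h1 : ∀ᵐ u ∂(endpointPMF t E).toMeasure, u < t := by
    rw [ae_iff, PMF.toMeasure_apply_eq_zero_iff _ (MeasurableSet.of_discrete),
      Set.disjoint_left]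
    intro u hu hut
    exact (PMF.mem_support_iff _ _).1 hu (h.endpointPMF_of_le ht (not_lt.1 hut))
  exact (Measure.quasiMeasurePreserving_eval
    (fun _ : Fin k => (endpointPMF t E).toMeasure) i).ae h1

theorem IsState.ae_isStep (hv : 0 < v) {t : ℕ} {E : EdgeMultiset} (h : IsState f G t E) :
    ∀ᵐ F ∂stepLaw f v t E, IsStep f v t E F := by
  by_cases ht : t < v
  · rw [stepLaw, if_pos ht, ae_dirac_iff MeasurableSet.of_discrete]
    exact Or.inl ⟨ht, rfl⟩
  · have hE := h.isValid
    rw [max_eq_left (by omega)] at hE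
    rw [stepLaw, if_neg ht, ae_map_iff Measurable.of_discrete.aemeasurable
      MeasurableSet.of_discrete]
    filter_upwards [ae_pi_lt hE (by omega) (f t)] with c hc
    exact Or.inr ⟨not_lt.1 ht, c, hc, rfl⟩

/-- A trajectory all of whose states and steps are as they should be. -/
structure IsTrajectory (f : ℕ → ℕ) {v : ℕ} (G : DiMultigraph v) (ω : ℕ → EdgeMultiset) :
    Prop where
  isState : ∀ t, IsState f G t (ω t)
  isStep : ∀ t, IsStep f v t (ω t) (ω (t + 1))

/-- Induction on time, then a countable intersection. Afterwards randomness enters only through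
one-step laws, and everything else is argued path by path. -/
theorem ae_isTrajectory (hv : 0 < v) (hG : G.NoIsolated) (hpos : ∀ t, v ≤ t → 1 ≤ f t) :
    ∀ᵐ ω ∂mpa f G, IsTrajectory f G ω := by
  have hstep : ∀ t, (∀ᵐ ω ∂mpa f G, IsState f G t (ω t)) →
      ∀ᵐ ω ∂mpa f G, IsStep f v t (ω t) (ω (t + 1)) := fun t h =>
    ae_next t (h.mono fun ω hω => hω.ae_isStep hv)
  have hstate : ∀ t, ∀ᵐ ω ∂mpa f G, IsState f G t (ω t) := by
    intro t
    induction t with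
    | zero =>
      filter_upwards [ae_zero (f := f) (G := G)] with ω hω
      rw [hω]
      exact ⟨by simpa using hG.isValid, (edgeCount_of_le (Nat.zero_le _)).symm⟩
    | succ t ih =>
      filter_upwards [ih, hstep t ih] with ω h1 h2
      exact h1.succ hpos h2
  filter_upwards [ae_all_iff.2 hstate, ae_all_iff.2 fun t => hstep t (hstate t)] with ω h1 h2
  exact ⟨h1, h2⟩

theorem IsTrajectory.monotone {ω : ℕ → EdgeMultiset} (h : IsTrajectory f G ω) : Monotone ω :=
  monotone_nat_of_le_succ fun t => (h.isStep t).le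

theorem IsTrajectory.isValid {ω : ℕ → EdgeMultiset} (h : IsTrajectory f G ω) {t : ℕ}
    (ht : v ≤ t) : IsValid t (ω t) := by
  have := (h.isState t).isValid
  rwa [max_eq_left ht] at this

/-- Edges between two nodes are added only when the later of them is added. -/
theorem IsTrajectory.joining_eq {ω : ℕ → EdgeMultiset} (h : IsTrajectory f G ω) {u w s t : ℕ}
    (hu : u < s) (hw : w < s) (hst : s ≤ t) : joining (ω t) u w = joining (ω s) u w := by
  induction t, hst using Nat.le_induction with
  | base => rfl
  | succ t hst ih =>
    rw [← ih]
    rcases h.isStep t with ⟨-, h1⟩ | ⟨-, c, -, h1⟩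
    · rw [h1]
    · rw [h1, joining_add_newEdges_of_ne _ (by omega) (by omega)]

end

section

/-! ### Numbers of hits in independent trials -/

theorem hits_le {k : ℕ} (c : Fin k → ℕ) (u : ℕ) : hits c u ≤ k :=
  (Finset.card_filter_le _ _).trans (by simp)

theorem hits_eq_zero {k : ℕ} {c : Fin k → ℕ} {u : ℕ} : hits c u = 0 ↔ ∀ i, c i ≠ u := by
  simp [hits, Finset.card_eq_zero, Finset.filter_eq_empty_iff]

theorem cast_hits {k : ℕ} (c : Fin k → ℕ) (u : ℕ) :
    (hits c u : ℝ) = ∑ i, if c i = u then (1 : ℝ) else 0 := by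
  simp [hits]

/-- Both sides count ordered pairs of distinct trials that hit `u`; this yields the second factorial
moment. -/
theorem hits_mul_hits_sub_one {k : ℕ} (c : Fin k → ℕ) (u : ℕ) :
    (hits c u : ℝ) * (hits c u - 1) = ∑ q ∈ (Finset.univ : Finset (Fin k)).offDiag,
      if c q.1 = u ∧ c q.2 = u then (1 : ℝ) else 0 := by
  set S := (Finset.univ : Finset (Fin k)).filter fun i => c i = u with hS
  have h : ((Finset.univ : Finset (Fin k)).offDiag.filter fun q => c q.1 = u ∧ c q.2 = u)
      = S.offDiag := by
    ext q
    simp [hS]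
    tauto
  rw [Finset.sum_boole, h, Finset.offDiag_card, Nat.cast_sub (Nat.le_mul_self _)]
  push_cast
  simp only [hits, ← hS]
  ring

theorem integral_boole (ν : Measure ℕ) {k : ℕ} {p : (Fin k → ℕ) → Prop} [DecidablePred p] :
    ∫ c, (if p c then (1 : ℝ) else 0) ∂(Measure.pi fun _ : Fin k => ν) =
      (Measure.pi fun _ : Fin k => ν).real {c | p c} := by
  rw [← integral_indicator_one (MeasurableSet.of_discrete)]
  refine integral_congr_ae (Eventually.of_forall fun c => ?_)
  simp [Set.indicator_apply]

variable (ν : Measure ℕ) [IsProbabilityMeasure ν] {k : ℕ}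

theorem integrable_pi_of_bound {g : (Fin k → ℕ) → ℝ} {C : ℝ} (h : ∀ c, |g c| ≤ C) :
    Integrable g (Measure.pi fun _ : Fin k => ν) :=
  Integrable.of_bound Measurable.of_discrete.aestronglyMeasurable C (Eventually.of_forall h)

theorem measureReal_pi_box (B : Fin k → Set ℕ) :
    (Measure.pi fun _ : Fin k => ν).real (Set.pi Set.univ B) = ∏ i, ν.real (B i) := by
  simp [measureReal_def, Measure.pi_pi, ENNReal.toReal_prod]

theorem measureReal_forall_mem_eq (S : Finset (Fin k)) (u : ℕ) :
    (Measure.pi fun _ : Fin k => ν).real {c | ∀ i ∈ S, c i = u} = ν.real {u} ^ S.card := by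
  have h : {c : Fin k → ℕ | ∀ i ∈ S, c i = u} =
      Set.pi Set.univ fun i => if i ∈ S then {u} else Set.univ := by
    ext c
    simp only [Set.mem_ofPred_eq, Set.mem_pi, Set.mem_univ, true_implies]
    refine forall_congr' fun i => ?_
    split_ifs with hi <;> simp [hi]
  rw [h, measureReal_pi_box]
  have : ∀ i, ν.real (if i ∈ S then {u} else Set.univ) = if i ∈ S then ν.real {u} else 1 :=
    fun i => by split_ifs <;> simp
  simp [this]

theorem integrable_boole {p : (Fin k → ℕ) → Prop} [DecidablePred p] :
    Integrable (fun c => if p c then (1 : ℝ) else 0) (Measure.pi fun _ : Fin k => ν) :=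
  integrable_pi_of_bound ν (C := 1) fun c => by split_ifs <;> simp

theorem integral_hits (u : ℕ) :
    ∫ c, (hits c u : ℝ) ∂(Measure.pi fun _ : Fin k => ν) = k * ν.real {u} := by
  simp_rw [cast_hits]
  rw [integral_finsetSum _ fun i _ => integrable_boole ν]
  have : ∀ i : Fin k, ∫ c, (if c i = u then (1 : ℝ) else 0) ∂(Measure.pi fun _ : Fin k => ν) =
      ν.real {u} := fun i => by
    rw [integral_boole]
    simpa using measureReal_forall_mem_eq ν {i} u
  simp [this]

theorem integral_hits_mul_hits_sub_one (u : ℕ) :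
    ∫ c, (hits c u : ℝ) * (hits c u - 1) ∂(Measure.pi fun _ : Fin k => ν) =
      k * (k - 1) * ν.real {u} ^ 2 := by
  simp_rw [hits_mul_hits_sub_one]
  rw [integral_finsetSum _ fun i _ => integrable_boole ν]
  have : ∀ q ∈ (Finset.univ : Finset (Fin k)).offDiag,
      ∫ c, (if c q.1 = u ∧ c q.2 = u then (1 : ℝ) else 0) ∂(Measure.pi fun _ : Fin k => ν) =
      ν.real {u} ^ 2 := fun q hq => by
    rw [integral_boole]
    have hne : q.1 ≠ q.2 := (Finset.mem_offDiag.1 hq).2.2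
    simpa [hne] using measureReal_forall_mem_eq ν {q.1, q.2} u
  rw [Finset.sum_congr rfl this, Finset.sum_const, Finset.offDiag_card, nsmul_eq_mul,
    Nat.cast_sub (Nat.le_mul_self _), Finset.card_univ, Fintype.card_fin]
  push_cast
  ring

/-- Newton interpolation of 1/(D + x) at x = 0, 1, 2; the remainder has the sign of n(n − 1)(n − 2),
nonnegative at natural numbers. Its terms are factorial moments, which are exact for independent
trials. -/
theorem inv_add_natCast_le {D : ℝ} (hD : 0 < D) (n : ℕ) :
    (D + n)⁻¹ ≤ D⁻¹ - n * (D * (D + 1))⁻¹ + n * (n - 1) * (D * (D + 1) * (D + 2))⁻¹ := by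
  have hn : (0 : ℝ) ≤ n * (n - 1) * (n - 2) := by
    rcases n with _ | _ | n
    · simp
    · simp
    · push_cast
      have : (0 : ℝ) ≤ n := n.cast_nonneg
      have h1 : (0 : ℝ) ≤ n + 1 + 1 - 1 := by linarith
      have h2 : (0 : ℝ) ≤ n + 1 + 1 - 2 := by linarith
      positivity
  have hn' : (0 : ℝ) ≤ n := n.cast_nonneg
  have : D⁻¹ - n * (D * (D + 1))⁻¹ + n * (n - 1) * (D * (D + 1) * (D + 2))⁻¹ - (D + n)⁻¹ =
      n * (n - 1) * (n - 2) * (D * (D + 1) * (D + 2) * (D + n))⁻¹ := by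
    have : D + n ≠ 0 := by positivity
    field_simp
    ring
  have h2 : 0 ≤ n * (n - 1) * (n - 2) * (D * (D + 1) * (D + 2) * (D + n))⁻¹ :=
    mul_nonneg hn (by positivity)
  linarith

/-- The hit probability is (D + 1)q rather than Dq so that D + 1 cancels in the linear term, leaving
exactly the relative decrease kq. This is why the inverse of degree − 1, and not of the degree, is
used later. -/
theorem integral_inv_add_hits_le {D q : ℝ} (hD : 0 < D) (u : ℕ) (hq : ν.real {u} = (D + 1) * q) :
    ∫ c, (D + hits c u)⁻¹ ∂(Measure.pi fun _ : Fin k => ν) ≤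
      D⁻¹ * (1 - k * q + (k * q) ^ 2) := by
  have hb : ∀ c : Fin k → ℕ, (0 : ℝ) ≤ hits c u ∧ (hits c u : ℝ) ≤ k := fun c =>
    ⟨Nat.cast_nonneg _, Nat.cast_le.2 (hits_le c u)⟩
  have i1 : Integrable (fun c => (hits c u : ℝ)) (Measure.pi fun _ : Fin k => ν) :=
    integrable_pi_of_bound ν (C := k) fun c => by rw [abs_of_nonneg (hb c).1]; exact (hb c).2
  have i2 : Integrable (fun c => (hits c u : ℝ) * (hits c u - 1))
      (Measure.pi fun _ : Fin k => ν) :=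
    integrable_pi_of_bound ν (C := k * (k + 1)) fun c => by
      have := hb c
      rw [abs_mul, abs_of_nonneg this.1]
      refine mul_le_mul this.2 (abs_le.2 ⟨?_, ?_⟩) (abs_nonneg _) (Nat.cast_nonneg _) <;> linarith
  have i3 : Integrable (fun c => D⁻¹ - hits c u * (D * (D + 1))⁻¹)
      (Measure.pi fun _ : Fin k => ν) := (integrable_const _).sub (i1.mul_const _)
  calc ∫ c, (D + hits c u)⁻¹ ∂(Measure.pi fun _ : Fin k => ν)
      ≤ ∫ c, (D⁻¹ - hits c u * (D * (D + 1))⁻¹ +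
          hits c u * (hits c u - 1) * (D * (D + 1) * (D + 2))⁻¹)
          ∂(Measure.pi fun _ : Fin k => ν) := by
        refine integral_mono (integrable_pi_of_bound ν (C := D⁻¹) fun c => ?_)
          (i3.add (i2.mul_const _))
          fun c => inv_add_natCast_le hD _
        have := (hb c).1
        rw [abs_of_nonneg (by positivity)]
        exact inv_anti₀ hD (by linarith)
    _ = D⁻¹ - k * ((D + 1) * q) * (D * (D + 1))⁻¹ +
          k * (k - 1) * ((D + 1) * q) ^ 2 * (D * (D + 1) * (D + 2))⁻¹ := by
        rw [integral_add i3 (i2.mul_const _),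
          integral_sub (integrable_const _) (i1.mul_const _), integral_mul_const,
          integral_mul_const, integral_hits, integral_hits_mul_hits_sub_one, hq]
        simp
    _ = D⁻¹ * (1 - k * q + (k * q) ^ 2 - (k * q ^ 2 * (D + 1) + (k * q) ^ 2) / (D + 2)) := by
        field_simp
        ring
    _ ≤ D⁻¹ * (1 - k * q + (k * q) ^ 2) := by
        refine mul_le_mul_of_nonneg_left ?_ (by positivity)
        have : 0 ≤ (k * q ^ 2 * (D + 1) + (k * q) ^ 2) / (D + 2) := by positivity
        linarith

theorem measureReal_hits_eq_zero (u : ℕ) :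
    (Measure.pi fun _ : Fin k => ν).real {c | hits c u = 0} = (1 - ν.real {u}) ^ k := by
  have h : {c : Fin k → ℕ | hits c u = 0} = Set.pi Set.univ fun _ => {u}ᶜ := by
    ext c
    simp [hits_eq_zero]
  rw [h, measureReal_pi_box, probReal_compl_eq_one_sub (measurableSet_singleton u)]
  simp

/-- One arrangement per set of hitting trials suffices: for each M-element set S of trials, those in
S follow a fixed pattern `τ` in order and all others avoid every `u i`. These events are boxes, and
disjoint because S is recovered as the set of trials landing among the `u i`. -/
theorem le_measureReal_hits_eq {n : ℕ} {u : Fin n → ℕ} (hu : Function.Injective u) (m : Fin n → ℕ)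
    {p : ℝ} (hp0 : 0 ≤ p) (hp : ∀ i, p ≤ ν.real {u i}) :
    k.choose (∑ i, m i) * (p ^ (∑ i, m i) * (1 - ∑ i, ν.real {u i}) ^ (k - ∑ i, m i)) ≤
      (Measure.pi fun _ : Fin k => ν).real {c | ∀ i, hits c (u i) = m i} := by
  classical
  set M := ∑ i, m i with hM
  let τ : Fin M → ℕ := fun b => u (finSigmaFinEquiv.symm b).1
  have hτ : ∀ i, (Finset.univ.filter fun b => τ b = u i).card = m i := by
    intro i
    have : (Finset.univ.filter fun b => τ b = u i).card =
        (Finset.univ.filter fun x : (i : Fin n) × Fin (m i) => x.1 = i).card := by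
      refine Finset.card_equiv finSigmaFinEquiv.symm fun b => ?_
      simp [τ, hu.eq_iff]
    rw [this]
    have : (Finset.univ.filter fun x : (i : Fin n) × Fin (m i) => x.1 = i) =
        (Finset.univ : Finset (Fin (m i))).map ⟨Sigma.mk i, sigma_mk_injective⟩ := by
      ext ⟨a, b⟩
      simp only [Finset.mem_filter, Finset.mem_univ, true_and, Finset.mem_map,
        Function.Embedding.coeFn_mk]
      constructor
      · rintro rfl
        exact ⟨b, rfl⟩
      · rintro ⟨b', hb'⟩
        exact (congrArg Sigma.fst hb').symm
    rw [this, Finset.card_map, Finset.card_univ, Fintype.card_fin]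
  set T := (Finset.univ : Finset (Fin k)).powersetCard M
  have hcard : ∀ S : T, S.1.card = M := fun S => (Finset.mem_powersetCard.1 S.2).2
  let B : T → Fin k → Set ℕ := fun S j =>
    if h : j ∈ S.1 then {τ (S.1.equivFinOfCardEq (hcard S) ⟨j, h⟩)} else (Set.range u)ᶜ
  let A : T → Set (Fin k → ℕ) := fun S => Set.pi Set.univ (B S)
  have hBmem : ∀ S j x, x ∈ B S j → (x ∈ Set.range u ↔ j ∈ S.1) := by
    intro S j x hx
    by_cases h : j ∈ S.1
    · simp only [B, dif_pos h, Set.mem_singleton_iff] at hx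
      subst hx
      exact iff_of_true ⟨_, rfl⟩ h
    · simp only [B, dif_neg h] at hx
      exact iff_of_false hx h
  have hdisj : Pairwise (Function.onFun Disjoint A) := by
    intro S S' hne
    refine Set.disjoint_left.2 fun c hc hc' => hne (Subtype.ext (Finset.ext fun j => ?_))
    exact (hBmem S j _ (hc j trivial)).symm.trans (hBmem S' j _ (hc' j trivial))
  have hsub : (⋃ S, A S) ⊆ {c | ∀ i, hits c (u i) = m i} := by
    refine Set.iUnion_subset fun S c hc i => ?_
    rw [← hτ i, hits]
    have h1 : (Finset.univ.filter fun j => c j = u i) =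
        (Finset.univ.filter fun j : S.1 => c j.1 = u i).map (Function.Embedding.subtype _) := by
      ext j
      simp only [Finset.mem_filter, Finset.mem_univ, true_and, Finset.mem_map,
        Function.Embedding.subtype_apply]
      constructor
      · intro h
        exact ⟨⟨j, (hBmem S j _ (hc j trivial)).1 (h ▸ ⟨i, rfl⟩)⟩, h, rfl⟩
      · rintro ⟨j, h, rfl⟩
        exact h
    rw [h1, Finset.card_map]
    refine Finset.card_equiv (S.1.equivFinOfCardEq (hcard S)) fun j => ?_
    have h2 := hc j.1 trivial
    simp only [B, dif_pos j.2, Set.mem_singleton_iff] at h2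
    simp [h2]
  have hU : ν.real (Set.range u)ᶜ = 1 - ∑ i, ν.real {u i} := by
    rw [probReal_compl_eq_one_sub MeasurableSet.of_discrete, ← Set.iUnion_singleton_eq_range,
      measureReal_iUnion_fintype]
    · intro i j hij
      simpa [Function.onFun] using hu.ne hij
    · exact fun i => measurableSet_singleton _
  have hA : ∀ S, p ^ M * (1 - ∑ i, ν.real {u i}) ^ (k - M) ≤
      (Measure.pi fun _ : Fin k => ν).real (A S) := by
    intro S
    rw [measureReal_pi_box, ← hU]
    calc p ^ M * ν.real (Set.range u)ᶜ ^ (k - M)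
        = ∏ j, if j ∈ S.1 then p else ν.real (Set.range u)ᶜ := by
          rw [Finset.prod_ite, Finset.prod_const, Finset.prod_const, Finset.filter_mem_eq_inter,
            Finset.univ_inter, hcard S, Finset.filter_not, Finset.filter_mem_eq_inter,
            Finset.univ_inter, Finset.card_sdiff_of_subset (Finset.subset_univ _), hcard S,
            Finset.card_univ, Fintype.card_fin]
      _ ≤ _ := by
          refine Finset.prod_le_prod (fun j _ => by split_ifs <;> positivity) fun j _ => ?_
          by_cases h : j ∈ S.1
          · simp only [B, if_pos h, dif_pos h]
            exact hp _
          · simp only [B, if_neg h, dif_neg h]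
            exact le_rfl
  calc _ = ∑ S : T, p ^ M * (1 - ∑ i, ν.real {u i}) ^ (k - M) := by
        rw [Finset.sum_const, nsmul_eq_mul, Finset.card_univ, Fintype.card_coe,
          Finset.card_powersetCard, Finset.card_univ, Fintype.card_fin]
    _ ≤ ∑ S : T, (Measure.pi fun _ : Fin k => ν).real (A S) := Finset.sum_le_sum fun S _ => hA S
    _ = (Measure.pi fun _ : Fin k => ν).real (⋃ S, A S) :=
        (measureReal_iUnion_fintype hdisj fun _ => MeasurableSet.of_discrete).symm
    _ ≤ _ := measureReal_mono hsub

end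

section

/-! ### Growth of the number of edges -/

/-- Quantitative form of `f t = Θ(t)` together with the resulting quadratic growth of the number of
edges, from time `T` on. -/
structure Growth (f : ℕ → ℕ) {v : ℕ} (G : DiMultigraph v) (a b c₁ c₂ : ℝ) (T : ℕ) : Prop where
  a_pos : 0 < a
  c₁_pos : 0 < c₁
  two_le : 2 ≤ T
  le_T : v ≤ T
  rate_le : c₂ / (2 * a) ≤ T
  le_f : ∀ t, T ≤ t → c₁ * t ≤ f t
  f_le : ∀ t, T ≤ t → (f t : ℝ) ≤ c₂ * t
  le_edgeCount : ∀ t, T ≤ t → a * t ^ 2 ≤ edgeCount f G t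
  edgeCount_le : ∀ t, T ≤ t → (edgeCount f G t : ℝ) ≤ b * t ^ 2

variable {f : ℕ → ℕ} {v : ℕ} {G : DiMultigraph v}

theorem exists_growth (hf : (fun t : ℕ => (f t : ℝ)) =Θ[atTop] (fun t : ℕ => (t : ℝ))) :
    ∃ a b c₁ c₂ T, Growth f G a b c₁ c₂ T := by
  obtain ⟨c₂, hc₂, hup⟩ := hf.1.exists_pos
  obtain ⟨c, hc, hlo⟩ := hf.2.exists_pos
  obtain ⟨T₁, hT₁⟩ := eventually_atTop.1 hup.bound
  obtain ⟨T₂, hT₂⟩ := eventually_atTop.1 hlo.bound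
  simp only [Real.norm_natCast] at hT₁ hT₂
  set T₀ := max (max T₁ T₂) (max v 1)
  set c₁ := c⁻¹ with hc₁
  have hc₁p : 0 < c₁ := inv_pos.2 hc
  have hfu : ∀ t, T₀ ≤ t → (f t : ℝ) ≤ c₂ * t := fun t ht => hT₁ t (by omega)
  have hfl : ∀ t, T₀ ≤ t → c₁ * t ≤ f t := fun t ht => by
    rw [hc₁, inv_mul_le_iff₀ hc]
    exact hT₂ t (by omega)
  have hsucc : ∀ t, T₀ ≤ t →
      (edgeCount f G (t + 1) : ℝ) = edgeCount f G t + f t := fun t ht => by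
    rw [edgeCount_succ (by omega)]
    push_cast
    rfl
  -- Centring the square at `T₀` makes the induction start from 0; for t ≥ 2T₀ one has t − T₀ ≥ t/2,
  -- whence the constant c₁/8 below.
  have hlow : ∀ t, T₀ ≤ t → c₁ / 2 * ((t : ℝ) - T₀) ^ 2 ≤ edgeCount f G t := by
    intro t ht
    induction t, ht using Nat.le_induction with
    | base => simp
    | succ t ht ih =>
      rw [hsucc t ht]
      have h1 := hfl t ht
      have h2 : (1 : ℝ) ≤ T₀ := by exact_mod_cast (by omega : 1 ≤ T₀)
      push_cast
      nlinarith
  have hupp : ∀ t, T₀ ≤ t → (edgeCount f G t : ℝ) ≤ edgeCount f G T₀ + c₂ * t ^ 2 := by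
    intro t ht
    induction t, ht using Nat.le_induction with
    | base => have : 0 ≤ c₂ * (T₀ : ℝ) ^ 2 := by positivity
              linarith
    | succ t ht ih =>
      rw [hsucc t ht]
      have h1 := hfu t ht
      have h2 : (0 : ℝ) ≤ t := t.cast_nonneg
      push_cast
      nlinarith [mul_nonneg hc₂.le h2]
  have hT₀ : 1 ≤ T₀ := by omega
  refine ⟨c₁ / 8, edgeCount f G T₀ + c₂, c₁, c₂, max (2 * T₀) ⌈c₂ / (2 * (c₁ / 8))⌉₊, by positivity,
    hc₁p, by omega, by omega, ?_, fun t ht => hfl t (by omega), fun t ht => hfu t (by omega),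
    fun t ht => ?_, fun t ht => ?_⟩
  · exact (Nat.le_ceil _).trans (Nat.cast_le.2 (le_max_right _ _))
  · refine le_trans ?_ (hlow t (by omega))
    have h1 : (2 * T₀ : ℝ) ≤ t := by exact_mod_cast (le_max_left _ _).trans ht
    have h2 : (t : ℝ) / 2 ≤ t - T₀ := by linarith
    have h3 : (0 : ℝ) ≤ t := t.cast_nonneg
    have h4 : ((t : ℝ) / 2) ^ 2 ≤ (t - T₀) ^ 2 := by gcongr
    nlinarith
  · refine (hupp t (by omega)).trans ?_
    have h1 : (1 : ℝ) ≤ t := by exact_mod_cast (by omega : 1 ≤ t)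
    have h2 : (1 : ℝ) ≤ (t : ℝ) ^ 2 := one_le_pow₀ h1
    have h3 : (0 : ℝ) ≤ edgeCount f G T₀ := Nat.cast_nonneg _
    nlinarith

/-- Half the relative increase of the number of edges at time `t`. -/
def rate (f : ℕ → ℕ) {v : ℕ} (G : DiMultigraph v) (t : ℕ) : ℝ := f t / (2 * edgeCount f G t)

/-- A correction factor, which decreases to `1` as `t` grows. -/
def damping (K : ℝ) (t : ℕ) : ℝ := Real.exp (K / (t - 1))

namespace Growth

variable {a b c₁ c₂ : ℝ} {T : ℕ}

theorem edgeCount_pos (h : Growth f G a b c₁ c₂ T) {t : ℕ} (ht : T ≤ t) :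
    (0 : ℝ) < edgeCount f G t := by
  have h1 := h.le_edgeCount t ht
  have h2 : (0 : ℝ) < t := by exact_mod_cast (by have := h.two_le; omega : 0 < t)
  have := h.a_pos
  exact lt_of_lt_of_le (by positivity) h1

theorem rate_nonneg (t : ℕ) : 0 ≤ rate f G t := by
  unfold rate
  positivity

theorem rate_le_div (h : Growth f G a b c₁ c₂ T) {t : ℕ} (ht : T ≤ t) :
    rate f G t ≤ c₂ / (2 * a) / t := by
  have h2 : (0 : ℝ) < t := by exact_mod_cast (by have := h.two_le; omega : 0 < t)
  have ha := h.a_pos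
  have h3 := h.le_edgeCount t ht
  have h4 := h.f_le t ht
  calc rate f G t ≤ c₂ * t / (2 * (a * t ^ 2)) := by
        unfold rate
        have : (0 : ℝ) ≤ f t := Nat.cast_nonneg _
        gcongr
        linarith
    _ = _ := by
        field_simp

theorem rate_le_one (h : Growth f G a b c₁ c₂ T) {t : ℕ} (ht : T ≤ t) : rate f G t ≤ 1 := by
  have h2 : (0 : ℝ) < t := by exact_mod_cast (by have := h.two_le; omega : 0 < t)
  refine (h.rate_le_div ht).trans ((div_le_one h2).2 (h.rate_le.trans ?_))
  exact_mod_cast ht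

theorem edgeCount_succ_eq (h : Growth f G a b c₁ c₂ T) {t : ℕ} (ht : T ≤ t) :
    (edgeCount f G (t + 1) : ℝ) = edgeCount f G t * (1 + 2 * rate f G t) := by
  have := h.edgeCount_pos ht
  rw [edgeCount_succ (h.le_T.trans ht), rate]
  push_cast
  field_simp

theorem sqrt_edgeCount_succ_le (h : Growth f G a b c₁ c₂ T) {t : ℕ} (ht : T ≤ t) :
    √(edgeCount f G (t + 1) : ℝ) ≤ √(edgeCount f G t : ℝ) * (1 + rate f G t) := by
  have h0 := rate_nonneg (f := f) (G := G) t
  rw [h.edgeCount_succ_eq ht, Real.sqrt_mul (Nat.cast_nonneg _)]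
  refine mul_le_mul_of_nonneg_left ?_ (Real.sqrt_nonneg _)
  rw [Real.sqrt_le_left (by linarith)]
  nlinarith

/-- With `sqrt_edgeCount_succ_le` this shows that the square root grows by 1 + r up to a factor 1 +
r²; squared, it reads (1 + r)² ≤ (1 + 2r)(1 + r²)². -/
theorem le_sqrt_edgeCount_succ (h : Growth f G a b c₁ c₂ T) {t : ℕ} (ht : T ≤ t) :
    √(edgeCount f G t : ℝ) * (1 + rate f G t) ≤
      √(edgeCount f G (t + 1) : ℝ) * (1 + rate f G t ^ 2) := by
  have h0 := rate_nonneg (f := f) (G := G) t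
  rw [h.edgeCount_succ_eq ht, Real.sqrt_mul (Nat.cast_nonneg _), mul_assoc]
  refine mul_le_mul_of_nonneg_left ?_ (Real.sqrt_nonneg _)
  set r := rate f G t
  refine le_of_sq_le_sq ?_ (by positivity)
  rw [mul_pow, Real.sq_sqrt (by linarith)]
  have h3 : 0 ≤ r ^ 3 := by positivity
  have h4 : 0 ≤ r ^ 4 := by positivity
  have h5 : 0 ≤ r ^ 5 := by positivity
  nlinarith [sq_nonneg r]

/-- The squared rates are at most C²/t² ≤ C²/(t − 1) − C²/t, which telescopes; the exponent of
`damping` is the remaining tail. -/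
theorem damping_succ_mul_le (h : Growth f G a b c₁ c₂ T) {t : ℕ} (ht : T ≤ t) :
    damping ((c₂ / (2 * a)) ^ 2) (t + 1) * (1 + rate f G t ^ 2) ≤
      damping ((c₂ / (2 * a)) ^ 2) t := by
  have h2 : (2 : ℝ) ≤ t := by exact_mod_cast h.two_le.trans ht
  have h1 := h.rate_le_div ht
  set C := c₂ / (2 * a)
  have h3 : rate f G t ^ 2 ≤ C ^ 2 / (t - 1) - C ^ 2 / t := by
    calc rate f G t ^ 2 ≤ (C / t) ^ 2 := by
          have := rate_nonneg (f := f) (G := G) t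
          gcongr
      _ = C ^ 2 / (t * t) := by rw [div_pow, sq (t : ℝ)]
      _ ≤ C ^ 2 / (t * (t - 1)) := by
          have : (0 : ℝ) < t - 1 := by linarith
          gcongr
          linarith
      _ = _ := by
          have : (t : ℝ) - 1 ≠ 0 := by linarith
          field_simp
          ring
  unfold damping
  push_cast
  rw [add_sub_cancel_right]
  calc Real.exp (C ^ 2 / t) * (1 + rate f G t ^ 2)
      ≤ Real.exp (C ^ 2 / t) * Real.exp (C ^ 2 / (t - 1) - C ^ 2 / t) := by
        gcongr
        have := Real.add_one_le_exp (C ^ 2 / (t - 1) - C ^ 2 / t)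
        linarith
    _ = _ := by
        rw [← Real.exp_add]
        congr 1
        ring

theorem one_le_damping {K : ℝ} (hK : 0 ≤ K) {t : ℕ} (ht : 2 ≤ t) : 1 ≤ damping K t := by
  have h2 : (2 : ℝ) ≤ t := by exact_mod_cast ht
  refine Real.one_le_exp (div_nonneg hK (by linarith))

end Growth

/-! ### Supermartingales along the process -/

/-- A nonnegative supermartingale converges almost surely, hence is bounded along almost every path.
Multiplying by the indicator of an event `Q` known at time `s` means that the drift inequality is
needed only on `Q`. -/
theorem ae_bddAbove_of_integral_le {s : ℕ} {Q : Set (ℕ → EdgeMultiset)}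
    (hQ : MeasurableSet[history s] Q) {V : ℕ → EdgeMultiset → ℝ} (hV : ∀ t E, 0 ≤ V t E)
    {C : ℕ → ℝ} (hC : ∀ t, s ≤ t → ∀ᵐ ω ∂mpa f G, V t (ω t) ≤ C t)
    (h : ∀ t, s ≤ t → ∀ᵐ ω ∂mpa f G, ω ∈ Q →
      ∫ y, V (t + 1) y ∂stepLaw f v t (ω t) ≤ V t (ω t)) :
    ∀ᵐ ω ∂mpa f G, ω ∈ Q → ∃ B, ∀ t, s ≤ t → V t (ω t) ≤ B := by
  let ℱ : Filtration ℕ (MeasurableSpace.pi : MeasurableSpace (ℕ → EdgeMultiset)) :=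
    ⟨fun n => history (s + n), fun i j hij => history.mono (by omega), fun n => history.le _⟩
  let X : ℕ → (ℕ → EdgeMultiset) → ℝ := fun n => Q.indicator fun ω => V (s + n) (ω (s + n))
  have hQ' : ∀ n, MeasurableSet[history (s + n)] Q := fun n => history.mono (by omega) Q hQ
  have hmeas : ∀ t, Measurable[history t] fun ω : ℕ → EdgeMultiset => V t (ω t) := fun t =>
    (Measurable.of_discrete (f := V t)).comp (measurable_history le_rfl)
  have hint : ∀ t, s ≤ t → Integrable (fun ω => V t (ω t)) (mpa f G) := fun t ht =>
    Integrable.of_bound ((hmeas t).mono (history.le t) le_rfl).aestronglyMeasurable (C t)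
      ((hC t ht).mono fun ω hω => by rwa [Real.norm_eq_abs, abs_of_nonneg (hV _ _)])
  have hXint : ∀ n, Integrable (X n) (mpa f G) := fun n =>
    (hint (s + n) (by omega)).indicator (history.le s Q hQ)
  have hX0 : ∀ n ω, 0 ≤ X n ω := fun n ω => Set.indicator_nonneg (fun ω _ => hV _ _) ω
  have hsup : Supermartingale X ℱ (mpa f G) := by
    refine supermartingale_nat (fun n => ?_) hXint fun n => ?_
    · exact ((hmeas (s + n)).indicator (hQ' n)).stronglyMeasurable
    · have h1 := condExp_indicator (m := history (s + n)) (hint (s + (n + 1)) (by omega)) (hQ' n)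
      have h2 := condExp_next (f := f) (G := G) (s + n) (g := V (s + n + 1))
        (hint (s + n + 1) (by omega))
      filter_upwards [h1, h2, h (s + n) (by omega)] with ω h1 h2 h3
      refine h1.le.trans ?_
      by_cases hω : ω ∈ Q
      · simp only [X, Set.indicator_of_mem hω]
        exact h2.le.trans (h3 hω)
      · simp only [X, Set.indicator_of_notMem hω, le_refl]
  -- By nonnegativity the L¹ norm is the expectation, which never exceeds its initial value.
  have hbdd : ∀ n, eLpNorm ((-X) n) 1 (mpa f G) ≤ ((∫ ω, X 0 ω ∂mpa f G).toNNReal : ℝ≥0∞) := by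
    intro n
    have h1 : ∫ ω, X n ω ∂mpa f G ≤ ∫ ω, X 0 ω ∂mpa f G := by
      have := hsup.setIntegral_le (Nat.zero_le n) (MeasurableSet.univ)
      simpa using this
    rw [Pi.neg_apply, eLpNorm_neg, eLpNorm_one_eq_lintegral_enorm,
      ← ofReal_integral_norm_eq_lintegral_enorm (hXint n)]
    refine ENNReal.ofReal_le_ofReal (le_trans (le_of_eq ?_) h1)
    exact integral_congr_ae (Eventually.of_forall fun ω => by
      simp only [Real.norm_eq_abs, abs_of_nonneg (hX0 n ω)])
  filter_upwards [hsup.neg.exists_ae_tendsto_of_bdd hbdd] with ω hω hωQ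
  obtain ⟨c, hc⟩ := hω
  obtain ⟨B, hB⟩ := hc.bddBelow_range
  refine ⟨-B, fun t ht => ?_⟩
  have h1 := hB ⟨t - s, rfl⟩
  simp only [Pi.neg_apply, X, Set.indicator_of_mem hωQ, Nat.add_sub_cancel' ht] at h1
  linarith

end

section

/-! ### Linear growth of degrees -/

variable {f : ℕ → ℕ} {v : ℕ} {G : DiMultigraph v}

theorem integral_stepLaw {t : ℕ} (ht : v ≤ t) (E : EdgeMultiset) (g : EdgeMultiset → ℝ) :
    ∫ y, g y ∂stepLaw f v t E =
      ∫ c, g (E + newEdges t c) ∂(Measure.pi fun _ : Fin (f t) => (endpointPMF t E).toMeasure) := by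
  rw [stepLaw, if_neg ht.not_gt, integral_map Measurable.of_discrete.aemeasurable
    Measurable.of_discrete.aestronglyMeasurable]

namespace IsTrajectory

variable {ω : ℕ → EdgeMultiset}

theorem measureReal_endpointPMF (h : IsTrajectory f G ω) {t u : ℕ} (ht : v ≤ t)
    (hu : u < t) : (endpointPMF t (ω t)).toMeasure.real {u} =
      degree (ω t) u * (1 / (2 * edgeCount f G t)) := by
  rw [(h.isValid ht).measureReal_endpointPMF (by omega) hu, (h.isState t).card_eq]
  ring

theorem degree_le (h : IsTrajectory f G ω) (t u : ℕ) : degree (ω t) u ≤ 2 * edgeCount f G t := by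
  rw [← (h.isState t).card_eq]
  exact degree_le_card _ _

theorem degree_pos (h : IsTrajectory f G ω) {t u : ℕ} (ht : v ≤ t) (hu : u < t) :
    0 < degree (ω t) u :=
  Nat.pos_of_ne_zero ((h.isValid ht).degree_ne_zero u hu)

theorem integral_degree (h : IsTrajectory f G ω) {t u : ℕ} (ht : v ≤ t)
    (hu : u < t) :
    ∫ y, (degree y u : ℝ) ∂stepLaw f v t (ω t) = degree (ω t) u * (1 + rate f G t) := by
  rw [integral_stepLaw ht]
  simp_rw [degree_add_newEdges (ω t) hu.ne, Nat.cast_add]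
  rw [integral_add (integrable_const _), integral_hits, h.measureReal_endpointPMF ht hu, rate]
  · simp
    ring
  · exact integrable_pi_of_bound _ (C := f t) fun c => by
      rw [abs_of_nonneg (Nat.cast_nonneg _)]
      exact Nat.cast_le.2 (hits_le c u)

theorem integral_inv_degree_le (h : IsTrajectory f G ω) {t u : ℕ} (ht : v ≤ t)
    (hu : u < t) (hd : 2 ≤ degree (ω t) u) :
    ∫ y, ((degree y u - 1 : ℕ) : ℝ)⁻¹ ∂stepLaw f v t (ω t) ≤
      ((degree (ω t) u - 1 : ℕ) : ℝ)⁻¹ * (1 - rate f G t + rate f G t ^ 2) := by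
  have hD : (0 : ℝ) < ((degree (ω t) u - 1 : ℕ) : ℝ) := by exact_mod_cast (by omega)
  have hq : (endpointPMF t (ω t)).toMeasure.real {u} =
      (((degree (ω t) u - 1 : ℕ) : ℝ) + 1) * (1 / (2 * edgeCount f G t)) := by
    rw [h.measureReal_endpointPMF ht hu]
    congr 1
    exact_mod_cast (by omega : degree (ω t) u = degree (ω t) u - 1 + 1)
  have := integral_inv_add_hits_le (k := f t) (endpointPMF t (ω t)).toMeasure hD u hq
  rw [integral_stepLaw ht]
  convert this using 2
  · ext c
    rw [degree_add_newEdges (ω t) hu.ne, ← Nat.cast_add]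
    congr 2
    omega
  · rw [rate]
    ring

theorem integral_degree_eq_one_le (h : IsTrajectory f G ω) {t u : ℕ} (ht : v ≤ t)
    (hu : u < t) :
    ∫ y, (if degree y u = 1 then (1 : ℝ) else 0) ∂stepLaw f v t (ω t) ≤
      (if degree (ω t) u = 1 then (1 : ℝ) else 0) / (1 + rate f G t) := by
  have hd := h.degree_pos ht hu
  rw [integral_stepLaw ht]
  simp_rw [degree_add_newEdges (ω t) hu.ne]
  split_ifs with h1
  · have h2 : ∀ c : Fin (f t) → ℕ, 1 + hits c u = 1 ↔ hits c u = 0 := fun c => by omega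
    simp_rw [h1, h2]
    rw [integral_boole, measureReal_hits_eq_zero]
    have hp := h.measureReal_endpointPMF ht hu
    set p := (endpointPMF t (ω t)).toMeasure.real {u}
    have hr : rate f G t = f t * p := by
      rw [hp, h1, rate]
      simp [div_eq_mul_inv]
    have hp0 : 0 ≤ p := measureReal_nonneg
    have hp1 : p ≤ 1 := measureReal_le_one
    rw [hr, le_div_iff₀ (by positivity)]
    -- Bernoulli's inequality turns the probability of no hit into a bound by 1/(1 + rate).
    calc (1 - p) ^ f t * (1 + f t * p) ≤ (1 - p) ^ f t * (1 + p) ^ f t := by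
          have : 0 ≤ 1 - p := by linarith
          gcongr
          exact one_add_mul_le_pow (by linarith) _
      _ = (1 - p ^ 2) ^ f t := by rw [← mul_pow]; ring
      _ ≤ 1 := pow_le_one₀ (by nlinarith) (by nlinarith)
  · have h2 : ∀ c : Fin (f t) → ℕ, ¬ (degree (ω t) u + hits c u = 1) := fun c => by omega
    simp [h2]

end IsTrajectory

variable {a b c₁ c₂ : ℝ} {T : ℕ}

theorem Growth.tendsto_sqrt_edgeCount (h : Growth f G a b c₁ c₂ T) :
    Tendsto (fun t => √(edgeCount f G t : ℝ)) atTop atTop := by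
  have ha := h.a_pos
  have h1 : Tendsto (fun t : ℕ => √a * (t : ℝ)) atTop atTop :=
    tendsto_natCast_atTop_atTop.const_mul_atTop (Real.sqrt_pos.2 ha)
  refine tendsto_atTop_mono' _ ?_ h1
  filter_upwards [eventually_ge_atTop T] with t ht
  refine (le_of_eq ?_).trans (Real.sqrt_le_sqrt (h.le_edgeCount t ht))
  rw [Real.sqrt_mul ha.le, Real.sqrt_sq (Nat.cast_nonneg _)]

section

variable (htraj : ∀ᵐ ω ∂mpa f G, IsTrajectory f G ω) (h : Growth f G a b c₁ c₂ T)
include htraj h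

theorem ae_degree_le (u : ℕ) :
    ∀ᵐ ω ∂mpa f G, ∃ B, ∀ t, max T (u + 1) ≤ t → (degree (ω t) u : ℝ) ≤ B * t := by
  set K := (c₂ / (2 * a)) ^ 2
  have hK : 0 ≤ K := sq_nonneg _
  have hT := h.two_le
  -- Dividing by the damping makes `x` grow by at least 1 + rate, the mean growth factor of the
  -- degree.
  set x : ℕ → ℝ := fun t => √(edgeCount f G t : ℝ) / damping K t with hx
  have hd : ∀ t, 0 < damping K t := fun t => Real.exp_pos _
  have hx0 : ∀ t, T ≤ t → 0 < x t := fun t ht =>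
    div_pos (Real.sqrt_pos.2 (h.edgeCount_pos ht)) (hd t)
  have hxs : ∀ t, T ≤ t → x t * (1 + rate f G t) ≤ x (t + 1) := fun t ht => by
    have h0 := Growth.rate_nonneg (f := f) (G := G) t
    simp only [hx]
    rw [div_mul_eq_mul_div, div_le_div_iff₀ (hd _) (hd _)]
    calc _ ≤ √(edgeCount f G (t + 1) : ℝ) * (1 + rate f G t ^ 2) * damping K (t + 1) :=
          mul_le_mul_of_nonneg_right (h.le_sqrt_edgeCount_succ ht) (hd _).le
      _ = √(edgeCount f G (t + 1) : ℝ) * (damping K (t + 1) * (1 + rate f G t ^ 2)) := by ring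
      _ ≤ _ := mul_le_mul_of_nonneg_left (h.damping_succ_mul_le ht) (Real.sqrt_nonneg _)
  have hxb : ∀ t, T ≤ t → x t ≤ √b * t := fun t ht => by
    refine (div_le_self (Real.sqrt_nonneg _) (Growth.one_le_damping hK (by omega))).trans ?_
    refine (Real.sqrt_le_sqrt (h.edgeCount_le t ht)).trans ?_
    rw [Real.sqrt_mul' _ (sq_nonneg _), Real.sqrt_sq (Nat.cast_nonneg _)]
  have key := ae_bddAbove_of_integral_le (f := f) (G := G) (s := max T (u + 1)) (Q := Set.univ)
    -- The absolute value gives nonnegativity at every time for free; from `T` on it is `x t`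
    -- itself.
    MeasurableSet.univ (V := fun t E => degree E u / |x t|) (fun t E => by positivity)
    (C := fun t => (2 * edgeCount f G t : ℕ) / |x t|)
    (fun t _ => htraj.mono fun ω hω => by
      have := hω.degree_le t u
      gcongr)
    (fun t ht => htraj.mono fun ω hω _ => by
      have hTt : T ≤ t := by omega
      have h1 := hx0 t hTt
      have h2 := hx0 (t + 1) (by omega)
      have h0 := Growth.rate_nonneg (f := f) (G := G) t
      simp only [abs_of_pos h1, abs_of_pos h2]
      rw [integral_div, hω.integral_degree (h.le_T.trans hTt) (by omega),
        div_le_div_iff₀ h2 h1, mul_assoc, mul_comm (1 + _)]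
      exact mul_le_mul_of_nonneg_left (hxs t hTt) (Nat.cast_nonneg _))
  filter_upwards [key] with ω hω
  obtain ⟨B, hB⟩ := hω trivial
  refine ⟨B * √b, fun t ht => ?_⟩
  have h1 := hx0 t (by omega)
  have h2 := hB t ht
  rw [abs_of_pos h1, div_le_iff₀ h1] at h2
  have h3 : 0 ≤ B := by
    refine le_trans ?_ (hB t ht)
    positivity
  calc (degree (ω t) u : ℝ) ≤ B * x t := h2
    _ ≤ B * (√b * t) := mul_le_mul_of_nonneg_left (hxb t (by omega)) h3
    _ = _ := by ring

theorem ae_exists_two_le_degree (u : ℕ) :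
    ∀ᵐ ω ∂mpa f G, ∃ s, max T (u + 1) ≤ s ∧ 2 ≤ degree (ω s) u := by
  have key := ae_bddAbove_of_integral_le (f := f) (G := G) (s := max T (u + 1)) (Q := Set.univ)
    MeasurableSet.univ
    (V := fun t E => √(edgeCount f G t : ℝ) * if degree E u = 1 then 1 else 0)
    (fun t E => by positivity) (C := fun t => √(edgeCount f G t : ℝ))
    (fun t _ => Eventually.of_forall fun ω =>
      mul_le_of_le_one_right (Real.sqrt_nonneg _) (by split_ifs <;> norm_num))
    (fun t ht => htraj.mono fun ω hω _ => by
      have hTt : T ≤ t := by omega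
      have h0 := Growth.rate_nonneg (f := f) (G := G) t
      rw [integral_const_mul]
      refine (mul_le_mul_of_nonneg_left (hω.integral_degree_eq_one_le (h.le_T.trans hTt)
        (by omega : u < t)) (Real.sqrt_nonneg _)).trans ?_
      rw [mul_div_assoc', div_le_iff₀ (by linarith)]
      have := h.sqrt_edgeCount_succ_le hTt
      split_ifs
      · linarith
      · simp)
  filter_upwards [key, htraj] with ω hω hωt
  obtain ⟨B, hB⟩ := hω trivial
  -- Once √e(t) exceeds the bound `B`, the indicator of degree 1 must vanish.
  obtain ⟨t, ht, htB⟩ := ((eventually_ge_atTop (max T (u + 1))).and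
    (h.tendsto_sqrt_edgeCount.eventually_gt_atTop B)).exists
  refine ⟨t, ht, ?_⟩
  have hvT := h.le_T
  have h1 := hωt.degree_pos (u := u) (t := t) (by omega) (by omega)
  by_contra h2
  have h3 := hB t ht
  rw [if_pos (by omega), mul_one] at h3
  linarith

theorem ae_le_degree_of_two_le {u s : ℕ} (hs : max T (u + 1) ≤ s) :
    ∀ᵐ ω ∂mpa f G, 2 ≤ degree (ω s) u →
      ∃ A, 0 < A ∧ ∀ t, s ≤ t → A * t ≤ (degree (ω t) u : ℝ) := by
  set K := (c₂ / (2 * a)) ^ 2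
  have hK : 0 ≤ K := sq_nonneg _
  have hT := h.two_le
  have ha := h.a_pos
  -- Now the damping multiplies, so that `y` grows slowly enough for the decrease 1 − r + r² of the
  -- mean inverse; note (1 + r)(1 − r + r²) = 1 + r³.
  set y : ℕ → ℝ := fun t => √(edgeCount f G t : ℝ) * damping K t with hy
  have hd : ∀ t, 0 < damping K t := fun t => Real.exp_pos _
  have hy0 : ∀ t, 0 ≤ y t := fun t => mul_nonneg (Real.sqrt_nonneg _) (hd t).le
  have hys : ∀ t, T ≤ t → y (t + 1) * (1 - rate f G t + rate f G t ^ 2) ≤ y t := fun t ht => by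
    have h0 := Growth.rate_nonneg (f := f) (G := G) t
    have h1 := h.rate_le_one ht
    have h2 := h.sqrt_edgeCount_succ_le ht
    have h3 := h.damping_succ_mul_le ht
    set r := rate f G t
    have h4 : 0 ≤ 1 - r + r ^ 2 := by nlinarith
    calc y (t + 1) * (1 - r + r ^ 2)
        ≤ √(edgeCount f G t : ℝ) * (1 + r) * damping K (t + 1) * (1 - r + r ^ 2) :=
          mul_le_mul_of_nonneg_right (mul_le_mul_of_nonneg_right h2 (hd _).le) h4
      _ = √(edgeCount f G t : ℝ) * (damping K (t + 1) * (1 + r ^ 2 * r)) := by ring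
      _ ≤ √(edgeCount f G t : ℝ) * (damping K (t + 1) * (1 + r ^ 2)) := by
          have := (hd (t + 1)).le
          gcongr
          exact mul_le_of_le_one_right (sq_nonneg _) h1
      _ ≤ _ := mul_le_mul_of_nonneg_left h3 (Real.sqrt_nonneg _)
  have hyb : ∀ t, T ≤ t → √a * t ≤ y t := fun t ht => by
    refine le_trans ?_ (le_mul_of_one_le_right (Real.sqrt_nonneg _)
      (Growth.one_le_damping hK (by omega)))
    refine le_trans (le_of_eq ?_) (Real.sqrt_le_sqrt (h.le_edgeCount t ht))
    rw [Real.sqrt_mul' _ (sq_nonneg _), Real.sqrt_sq (Nat.cast_nonneg _)]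
  have key := ae_bddAbove_of_integral_le (f := f) (G := G) (s := s)
    (Q := {ω | 2 ≤ degree (ω s) u})
    (measurable_history le_rfl (MeasurableSet.of_discrete (s := {E | 2 ≤ degree E u})))
    -- At degree at most 1 the inverse takes the default value 0, which would spoil the drift
    -- inequality; on `Q` this cannot occur, as degrees never decrease.
    (V := fun t E => y t * ((degree E u - 1 : ℕ) : ℝ)⁻¹)
    (fun t E => mul_nonneg (hy0 t) (by positivity)) (C := y)
    (fun t _ => Eventually.of_forall fun ω =>
      mul_le_of_le_one_right (hy0 t) (Nat.cast_inv_le_one _))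
    (fun t ht => htraj.mono fun ω hω hQ => by
      have hTt : T ≤ t := by omega
      have hd2 : 2 ≤ degree (ω t) u := le_trans hQ (degree_mono (hω.monotone ht) u)
      rw [integral_const_mul]
      refine (mul_le_mul_of_nonneg_left (hω.integral_inv_degree_le (h.le_T.trans hTt)
        (by omega) hd2) (hy0 _)).trans ?_
      rw [mul_left_comm, mul_comm (y t)]
      exact mul_le_mul_of_nonneg_left (hys t hTt) (by positivity))
  filter_upwards [key, htraj] with ω hω hωt hQ
  obtain ⟨B, hB⟩ := hω hQ
  have hd2 : ∀ t, s ≤ t → (0 : ℝ) < ((degree (ω t) u - 1 : ℕ) : ℝ) := fun t ht => by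
    have := le_trans hQ (degree_mono (hωt.monotone ht) u)
    exact_mod_cast (by omega)
  have hB0 : 0 ≤ B := le_trans (mul_nonneg (hy0 s) (by positivity)) (hB s le_rfl)
  refine ⟨√a / (B + 1), by positivity, fun t ht => ?_⟩
  have h1 := hB t ht
  have h2 := hd2 t ht
  rw [← div_eq_mul_inv, div_le_iff₀ h2] at h1
  have h3 := hyb t (by omega)
  have h4 : ((degree (ω t) u - 1 : ℕ) : ℝ) ≤ degree (ω t) u := Nat.cast_le.2 (Nat.sub_le _ _)
  rw [div_mul_eq_mul_div, div_le_iff₀ (by linarith)]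
  nlinarith

/-- Almost surely, all degrees grow linearly. -/
theorem ae_degree_linear :
    ∀ᵐ ω ∂mpa f G, ∀ u, ∃ A B : ℝ, 0 < A ∧
      ∀ᶠ t : ℕ in atTop, A * t ≤ degree (ω t) u ∧ (degree (ω t) u : ℝ) ≤ B * t := by
  refine ae_all_iff.2 fun u => ?_
  -- The time at which degree 2 is reached is random, so all deterministic `s` are treated at once.
  have h1 : ∀ᵐ ω ∂mpa f G, ∀ s, max T (u + 1) ≤ s → 2 ≤ degree (ω s) u →
      ∃ A, 0 < A ∧ ∀ t, s ≤ t → A * t ≤ (degree (ω t) u : ℝ) :=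
    ae_all_iff.2 fun s => eventually_imp_distrib_left.2 fun hs => ae_le_degree_of_two_le htraj h hs
  filter_upwards [h1, ae_degree_le htraj h u, ae_exists_two_le_degree htraj h u]
    with ω h1 ⟨B, hB⟩ ⟨s, hs, hs2⟩
  obtain ⟨A, hA, hA2⟩ := h1 s hs hs2
  refine ⟨A, B, hA, ?_⟩
  filter_upwards [eventually_ge_atTop s] with t ht
  exact ⟨hA2 t ht, hB t (hs.trans ht)⟩

end

end

section

/-! ### The extension property -/

open Nat in
-- A Poisson-type lower bound, uniform in `k`: the binomial coefficient is at least (k/2)^M / M!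
-- when k ≥ 2M, and 1 − P ≥ exp(−2P) when P ≤ 1/2.
theorem le_choose_mul_pow {k M : ℕ} {p P α γ : ℝ} (hk : 2 * M ≤ k) (hα : 0 ≤ α) (hp0 : 0 ≤ p)
    (hp : α ≤ k * p) (hP0 : 0 ≤ P) (hP : P ≤ 1 / 2) (hγ : k * P ≤ γ) :
    (α / 2) ^ M / M ! * Real.exp (-(2 * γ)) ≤ k.choose M * (p ^ M * (1 - P) ^ (k - M)) := by
  have h1 : (α / 2) ^ M / M ! ≤ k.choose M * p ^ M := by
    have hfac : (0 : ℝ) < M ! := by exact_mod_cast M.factorial_pos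
    rw [div_le_iff₀ hfac]
    have h2 : ((k + 1 - M : ℕ) : ℝ) ^ M ≤ k.choose M * M ! := by
      have := Nat.pow_sub_le_descFactorial k M
      rw [Nat.descFactorial_eq_factorial_mul_choose, mul_comm] at this
      exact_mod_cast this
    have h3 : (k : ℝ) / 2 ≤ ((k + 1 - M : ℕ) : ℝ) := by
      have : (k : ℝ) ≤ 2 * ((k + 1 - M : ℕ) : ℝ) := by exact_mod_cast (by omega)
      linarith
    calc (α / 2) ^ M ≤ ((k : ℝ) / 2 * p) ^ M := by
          gcongr
          linarith
      _ = ((k : ℝ) / 2) ^ M * p ^ M := mul_pow _ _ _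
      _ ≤ (k.choose M * M !) * p ^ M := by
          refine mul_le_mul_of_nonneg_right (le_trans ?_ h2) (by positivity)
          gcongr
      _ = _ := by ring
  have h2 : Real.exp (-(2 * γ)) ≤ (1 - P) ^ (k - M) := by
    have h3 : Real.exp (-(2 * P)) ≤ 1 - P := by
      rw [Real.exp_neg, inv_le_comm₀ (Real.exp_pos _) (by linarith)]
      refine le_trans ?_ (Real.add_one_le_exp (2 * P))
      rw [inv_le_iff_one_le_mul₀ (by linarith)]
      nlinarith
    calc Real.exp (-(2 * γ)) ≤ Real.exp (k * -(2 * P)) := Real.exp_le_exp.2 (by linarith)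
      _ = Real.exp (-(2 * P)) ^ k := Real.exp_nat_mul _ _
      _ ≤ (1 - P) ^ k := by gcongr
      _ ≤ (1 - P) ^ (k - M) := pow_le_pow_of_le_one (by linarith) (by linarith) (Nat.sub_le _ _)
  rw [← mul_assoc]
  exact mul_le_mul h1 h2 (Real.exp_pos _).le (by positivity)

variable {f : ℕ → ℕ} {v : ℕ} {G : DiMultigraph v}

theorem IsTrajectory.integral_joining_eq {ω : ℕ → EdgeMultiset} (h : IsTrajectory f G ω) {t n : ℕ}
    (ht : v ≤ t) {u : Fin n → ℕ} (hut : ∀ i, u i < t) (m : Fin n → ℕ) :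
    ∫ y, (if ∀ i, joining y (u i) t = m i then (1 : ℝ) else 0) ∂stepLaw f v t (ω t) =
      (Measure.pi fun _ : Fin (f t) => (endpointPMF t (ω t)).toMeasure).real
        {c | ∀ i, hits c (u i) = m i} := by
  rw [integral_stepLaw ht, ← integral_boole]
  simp_rw [joining_add_newEdges_self (ω t) (hut _).ne, (h.isValid ht).joining_eq_zero, zero_add]

/-- Along a trajectory with linearly growing degrees, the conditional probability that a new node is
joined to finitely many given nodes by given numbers of edges stays away from zero. -/
theorem IsTrajectory.exists_le_integral {a b c₁ c₂ : ℝ} {T : ℕ} (hgr : Growth f G a b c₁ c₂ T)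
    {ω : ℕ → EdgeMultiset} (h : IsTrajectory f G ω)
    (hlin : ∀ u, ∃ A B : ℝ, 0 < A ∧
      ∀ᶠ t : ℕ in atTop, A * t ≤ degree (ω t) u ∧ (degree (ω t) u : ℝ) ≤ B * t)
    {n : ℕ} {u : Fin n → ℕ} (hu : Function.Injective u) (m : Fin n → ℕ) :
    ∃ δ : ℝ, 0 < δ ∧ ∀ᶠ t : ℕ in atTop,
      δ ≤ ∫ y, (if ∀ i, joining y (u i) t = m i then (1 : ℝ) else 0) ∂stepLaw f v t (ω t) := by
  choose A B hA hAB using fun i => hlin (u i)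
  have ha := hgr.a_pos
  have hc₁ := hgr.c₁_pos
  -- A positive lower bound for all `A i` that also makes sense when `n = 0`.
  set A₀ := (1 + ∑ i, (A i)⁻¹)⁻¹ with hA₀
  have hsum : ∀ i, (A i)⁻¹ ≤ ∑ i, (A i)⁻¹ := fun i =>
    Finset.single_le_sum (f := fun i => (A i)⁻¹) (fun j _ => (inv_pos.2 (hA j)).le)
      (Finset.mem_univ i)
  have hA₀p : 0 < A₀ := by
    have : 0 ≤ ∑ i, (A i)⁻¹ := Finset.sum_nonneg fun j _ => (inv_pos.2 (hA j)).le
    positivity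
  have hA₀le : ∀ i, A₀ ≤ A i := fun i => by
    have := hsum i
    rw [hA₀]
    exact inv_le_of_inv_le₀ (hA i) (by linarith)
  have hT2 := hgr.two_le
  have hb : 0 < b := by
    have h1 := hgr.edgeCount_pos le_rfl
    have h2 := hgr.edgeCount_le T le_rfl
    exact pos_of_mul_pos_left (h1.trans_le h2) (sq_nonneg _)
  set M := ∑ i, m i
  -- `α` bounds the mean number of hits of each `u i` from below; β/t bounds the total hit
  -- probability of one trial from above, so c₂β bounds the mean number of all hits.
  set α := A₀ * c₁ / (2 * b) with hα
  set β := (∑ i, B i) / (2 * a) with hβ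
  refine ⟨(α / 2) ^ M / M.factorial * Real.exp (-(2 * (c₂ * β))), by positivity, ?_⟩
  have hlarge : ∀ C : ℝ, ∀ᶠ t : ℕ in atTop, C ≤ (t : ℝ) := fun C =>
    tendsto_natCast_atTop_atTop.eventually_ge_atTop C
  filter_upwards [eventually_all.2 hAB, eventually_ge_atTop T,
    eventually_all.2 fun i => eventually_gt_atTop (u i), hlarge (2 * M / c₁), hlarge (2 * β)]
    with t hAB ht hut hM hβt
  have hvt := hgr.le_T.trans ht
  have htp : (0 : ℝ) < t := by exact_mod_cast (by omega : 0 < t)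
  have hep := hgr.edgeCount_pos ht
  have hν := fun i => h.measureReal_endpointPMF hvt (hut i)
  rw [h.integral_joining_eq hvt hut]
  set ν := (endpointPMF t (ω t)).toMeasure
  have hf1 := hgr.le_f t ht
  have hf2 := hgr.f_le t ht
  have he1 := hgr.le_edgeCount t ht
  have he2 := hgr.edgeCount_le t ht
  have hp : ∀ i, A₀ * t * (1 / (2 * edgeCount f G t)) ≤ ν.real {u i} := fun i => by
    rw [hν i]
    refine mul_le_mul_of_nonneg_right ?_ (by positivity)
    exact (mul_le_mul_of_nonneg_right (hA₀le i) htp.le).trans (hAB i).1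
  have hP0 : 0 ≤ ∑ i, ν.real {u i} := Finset.sum_nonneg fun i _ => measureReal_nonneg
  have hPβ : ∑ i, ν.real {u i} ≤ β / t := by
    have h1 : ∑ i, (degree (ω t) (u i) : ℝ) ≤ (∑ i, B i) * t := by
      rw [Finset.sum_mul]
      exact Finset.sum_le_sum fun i _ => (hAB i).2
    have h2 : (0 : ℝ) ≤ ∑ i, (degree (ω t) (u i) : ℝ) := Finset.sum_nonneg fun i _ => by positivity
    calc ∑ i, ν.real {u i} = (∑ i, (degree (ω t) (u i) : ℝ)) / (2 * edgeCount f G t) := by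
          simp_rw [hν, ← Finset.sum_mul]
          ring
      _ ≤ (∑ i, B i) * t / (2 * (a * t ^ 2)) := by
          gcongr
          exact h2.trans h1
      _ = β / t := by
          rw [hβ]
          field_simp
  have hβ0 : 0 ≤ β := by
    have := hP0.trans hPβ
    rwa [le_div_iff₀ htp, zero_mul] at this
  refine le_trans (le_choose_mul_pow ?_ (by positivity) (by positivity) ?_ hP0 ?_ ?_)
    (le_measureReal_hits_eq ν hu m (by positivity) hp)
  · rw [div_le_iff₀ hc₁] at hM
    have : (2 * M : ℝ) ≤ f t := by linarith
    exact_mod_cast this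
  · calc α = c₁ * t * (A₀ * t * (1 / (2 * (b * t ^ 2)))) := by
          rw [hα]
          field_simp
      _ ≤ _ := by gcongr
  · refine hPβ.trans ?_
    rw [div_le_iff₀ htp]
    linarith
  · calc (f t : ℝ) * ∑ i, ν.real {u i} ≤ c₂ * t * (β / t) :=
          mul_le_mul hf2 hPβ hP0 ((Nat.cast_nonneg _).trans hf2)
      _ = c₂ * β := by field_simp

theorem ae_frequently_joining_eq {a b c₁ c₂ : ℝ} {T : ℕ} (hgr : Growth f G a b c₁ c₂ T)
    (htraj : ∀ᵐ ω ∂mpa f G, IsTrajectory f G ω) {n : ℕ} {u : Fin n → ℕ}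
    (hu : Function.Injective u) (m : Fin n → ℕ) :
    ∀ᵐ ω ∂mpa f G, ∃ᶠ t in atTop, ∀ i, joining (ω (t + 1)) (u i) t = m i := by
  classical
  -- Node `k - 1` arrives in the step to time `k`; the shift makes the event measurable at time `k`,
  -- as Lévy's lemma requires.
  let s : ℕ → Set (ℕ → EdgeMultiset) := fun k => {ω | ∀ i, joining (ω k) (u i) (k - 1) = m i}
  let g : ℕ → EdgeMultiset → ℝ := fun t y => if ∀ i, joining y (u i) t = m i then 1 else 0
  have hs : ∀ k, MeasurableSet[history k] (s k) := fun k =>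
    measurable_history le_rfl
      (MeasurableSet.of_discrete (s := {E | ∀ i, joining E (u i) (k - 1) = m i}))
  have hsg : ∀ t, (s (t + 1)).indicator (1 : (ℕ → EdgeMultiset) → ℝ) = fun ω => g t (ω (t + 1)) :=
    fun t => by
      ext ω
      simp [Set.indicator_apply, s, g]
  have hcond : ∀ᵐ ω ∂mpa f G, ∀ t,
      ((mpa f G)[(s (t + 1)).indicator (1 : (ℕ → EdgeMultiset) → ℝ) | history t]) ω =
        ∫ y, g t y ∂stepLaw f v t (ω t) := by
    refine ae_all_iff.2 fun t => ?_
    rw [hsg t]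
    refine condExp_next t ?_
    rw [← hsg t]
    exact (integrable_const 1).indicator (history.le _ _ (hs (t + 1)))
  filter_upwards [ae_mem_limsup_atTop_iff (mpa f G) hs, hcond, htraj,
    ae_degree_linear htraj hgr] with ω h1 h2 h3 h4
  simp_rw [h2] at h1
  have h5 : ω ∈ limsup s atTop := by
    rw [h1, ← not_summable_iff_tendsto_nat_atTop_of_nonneg]
    -- Conditional probabilities that are eventually at least `δ` do not tend to 0, so their sum
    -- diverges.
    · intro hsum
      obtain ⟨δ, hδ, hδt⟩ := h3.exists_le_integral hgr h4 hu m
      obtain ⟨t, ht1, ht2⟩ :=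
        ((hsum.tendsto_atTop_zero.eventually (gt_mem_nhds hδ)).and hδt).exists
      exact absurd ht1 ht2.not_gt
    · intro t
      refine integral_nonneg fun y => ?_
      simp only [g, Pi.zero_apply]
      split_ifs <;> norm_num
  rw [mem_limsup_iff_frequently_mem] at h5
  refine frequently_atTop.2 fun N => ?_
  obtain ⟨k, hk, hks⟩ := frequently_atTop.1 h5 (N + 1)
  refine ⟨k - 1, by omega, ?_⟩
  rw [Nat.sub_add_cancel (by omega)]
  exact hks

/-! ### The infinite limit -/

/-- Multiplicities freeze once both nodes are present, so any later time computes the limit. -/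
theorem IsTrajectory.limit_iff {ω : ℕ → EdgeMultiset} (h : IsTrajectory f G ω) {j u w s : ℕ}
    (huw : u ≠ w) (hu : u < s) (hw : w < s) :
    (limit ω).E j u w ↔ j ≤ joining (ω s) u w := by
  constructor
  · rintro ⟨t, hut, hwt, ⟨rfl, -⟩ | ⟨-, h2⟩⟩
    · exact Nat.zero_le _
    · rcases le_total s t with hst | hst
      · rwa [h.joining_eq hu hw hst] at h2
      · exact h2.trans (joining_mono (h.monotone hst) u w)
  · intro hj
    refine ⟨s, hu, hw, ?_⟩
    rcases Nat.eq_zero_or_pos j with rfl | hj0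
    · exact Or.inl ⟨rfl, huw⟩
    · exact Or.inr ⟨hj0, hj⟩

theorem IsTrajectory.not_limit_self {ω : ℕ → EdgeMultiset} (h : IsTrajectory f G ω) (j u : ℕ) :
    ¬ (limit ω).E j u u := by
  rintro ⟨t, -, -, ⟨-, h1⟩ | ⟨h1, h2⟩⟩
  · exact h1 rfl
  · rw [(h.isState t).isValid.joining_self] at h2
    omega

theorem IsTrajectory.isRadoMultigraph {ω : ℕ → EdgeMultiset} (h : IsTrajectory f G ω)
    (hext : ∀ (n : ℕ) (m u : Fin n → ℕ), Function.Injective u →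
      ∃ᶠ t in atTop, ∀ i, joining (ω (t + 1)) (u i) t = m i) :
    IsRadoMultigraph (limit ω) := by
  have hiff : ∀ {j u w : ℕ}, u ≠ w →
      ((limit ω).E j u w ↔ j ≤ joining (ω (max u w + 1)) u w) := fun huw =>
    h.limit_iff huw (by omega) (by omega)
  have hne : ∀ {j u w : ℕ}, (limit ω).E j u w → u ≠ w := fun {j u w} hE huw =>
    h.not_limit_self j u (by rwa [← huw] at hE)
  refine ⟨inferInstance, inferInstance, fun x y hxy => (hiff hxy).2 (Nat.zero_le _),
    fun j u w hE => ?_, h.not_limit_self, fun j u w hE => ?_, fun u w => ?_, fun n m u hu => ?_⟩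
  · have := hne hE
    rw [hiff this.symm, max_comm, joining_comm]
    exact (hiff this).1 hE
  · have := hne hE
    exact (hiff this).2 ((Nat.le_succ j).trans ((hiff this).1 hE))
  · by_cases huw : u = w
    · exact ⟨0, huw ▸ h.not_limit_self 0 u⟩
    · exact ⟨joining (ω (max u w + 1)) u w + 1, fun hE => absurd ((hiff huw).1 hE) (by omega)⟩
  -- Infinitely many `t` are available, so one lies beyond all `u i`; that node is the witness.
  · obtain ⟨t, ht, hut⟩ := ((hext n m u hu).and_eventually
      (eventually_all.2 fun i => eventually_gt_atTop (u i))).exists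
    refine ⟨t, fun i => ?_⟩
    have hi := hut i
    rw [h.limit_iff hi.ne (hi.trans t.lt_succ_self) t.lt_succ_self,
      h.limit_iff hi.ne (hi.trans t.lt_succ_self) t.lt_succ_self, ht i]
    omega

end

end PrefAttach

end

theorem theorem3p3 (f : ℕ → ℕ) (v : ℕ) (hv : 0 < v) (G : PrefAttach.DiMultigraph v)
    (hG : G.NoIsolated) (hpos : ∀ t, v ≤ t → 1 ≤ f t)
    (hf : (fun t : ℕ => (f t : ℝ)) =Θ[Filter.atTop] (fun t : ℕ => (t : ℝ))) :
    ∀ᵐ E ∂(PrefAttach.mpa f G),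
      PrefAttach.IsRadoMultigraph (PrefAttach.limit E) ∧
      ∀ (W : Type*) (R : PrefAttach.MultiStr W), PrefAttach.IsRadoMultigraph R →
        Nonempty (PrefAttach.MultiStr.Iso (PrefAttach.limit E) R) := by
  obtain ⟨a, b, c₁, c₂, T, hgr⟩ := PrefAttach.exists_growth (G := G) hf
  have htraj := PrefAttach.ae_isTrajectory hv hG hpos
  have hext : ∀ᵐ E ∂(PrefAttach.mpa f G), ∀ (n : ℕ) (m u : Fin n → ℕ), Function.Injective u →
      ∃ᶠ t in atTop, ∀ i, PrefAttach.joining (E (t + 1)) (u i) t = m i :=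
    -- There are countably many triples `(n, m, u)`, so one null set serves all of them.
    ae_all_iff.2 fun n => ae_all_iff.2 fun m => ae_all_iff.2 fun u =>
      eventually_imp_distrib_left.2 fun hu => PrefAttach.ae_frequently_joining_eq hgr htraj hu m
  filter_upwards [htraj, hext] with E h1 h2
  have hE := h1.isRadoMultigraph h2
  exact ⟨hE, fun W R hR => hE.nonempty_iso hR⟩
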